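/- All graphs are finite and simple. For graphs $H$ and $F$ and an integer $m \ge 0$, let $\mathrm{mex}(m,H,F)$ denote the maximum number of copies of $H$ (i.e. subgraphs isomorphic to $H$) in a graph with exactly $m$ edges, on any number of vertices, that contains no subgraph isomorphic to $F$. Let $K_r$ be the complete graph on $r$ vertices and $C_l$ the cycle on $l$ vertices, and let $G \vee H$ denote the join of $G$ and $H$, i.e. their disjoint union together with all edges between $V(G)$ and $V(H)$. **Theorem.** Let $r \ge 3$, $l \ge 4$ and $s \ge 1$ be integers. (i) If for some integer $t \ge 2$ either $l = 2t$ and $r \ge s+2$, or $l = 2t+1$ and $r \ge s+3$, then $$\mathrm{mex}(m, K_r, K_s \vee C_l) = O\left(m^{\frac{s+1}{2} + \frac{1}{2t}}\right).$$ (ii) Otherwise, $$\mathrm{mex}(m, K_r, K_s \vee C_l) = \Theta\left(m^{\frac{r}{2}}\right).$$ Here $r, l, s$ are fixed and the asymptotics are for $m \to \infty$, so that the implied constants may depend on $r$, $l$ and $s$ only. -/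

import Mathlib

/-- The join `G ∨ H`: the disjoint union of `G` and `H` together with all edges between them. -/
def graphJoin {V W : Type*} (G : SimpleGraph V) (H : SimpleGraph W) : SimpleGraph (V ⊕ W) :=
  (G ⊕g H) ⊔ completeBipartiteGraph V W

/-- The numbers of `H`-copies (subgraphs isomorphic to `H`) that occur in finite `F`-free simple
graphs with exactly `m` edges. Up to isomorphism, every finite graph lives on some `Fin n`. -/
def mexValues {V W : Type*} (m : ℕ) (H : SimpleGraph V) (F : SimpleGraph W) : Set ℕ :=
  {k | ∃ (n : ℕ) (G : SimpleGraph (Fin n)),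
    F.Free G ∧ G.edgeSet.ncard = m ∧ G.copyCount H = k}

/-- `mex m H F` is the maximum number of `H`-copies in an `F`-free graph with `m` edges. -/
noncomputable def mex {V W : Type*} (m : ℕ) (H : SimpleGraph V) (F : SimpleGraph W) : ℕ :=
  sSup (mexValues m H F)

/-- A graph without isolated vertices has at most `2 ^ m` copies in a graph with `m` edges. -/
theorem mexValues_bddAbove {V W : Type*} (m : ℕ) (H : SimpleGraph V) (F : SimpleGraph W)
    (hH : ∀ v, ∃ w, H.Adj v w) : BddAbove (mexValues m H F) := by
  classical
  refine ⟨2 ^ m, ?_⟩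
  rintro k ⟨n, G, -, hm, rfl⟩
  have hm' : G.edgeFinset.card = m := by
    rw [← hm, ← SimpleGraph.coe_edgeFinset, Set.ncard_coe_finset]
  rw [← hm', ← Finset.card_powerset, SimpleGraph.copyCount]
  refine Finset.card_le_card_of_injOn (fun G' => G'.edgeSet.toFinset) ?_ ?_
  · intro G' _
    simp only [Finset.coe_powerset, Set.mem_preimage, Set.mem_powerset_iff]
    intro e he
    simp only [Finset.mem_coe, Set.mem_toFinset] at he
    simpa using G'.edgeSet_subset he
  · intro A hA B hB hAB
    have hsupp : ∀ C : G.Subgraph, Nonempty (H ≃g C.coe) → ∀ v, v ∈ C.verts ↔ ∃ w, C.Adj v w := by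
      rintro C ⟨e⟩ v
      constructor
      · intro hv
        obtain ⟨w, hw⟩ := hH (e.symm ⟨v, hv⟩)
        refine ⟨e w, ?_⟩
        have := e.map_adj_iff.2 hw
        simpa using this
      · rintro ⟨w, hw⟩
        exact C.edge_vert hw
    have hadj : ∀ a b, A.Adj a b ↔ B.Adj a b := by
      intro a b
      have := congrArg (fun S => s(a, b) ∈ S) hAB
      simpa using this
    simp only [Finset.coe_filter, Finset.mem_univ, true_and, Set.mem_ofPred_eq] at hA hB
    refine SimpleGraph.Subgraph.ext ?_ ?_
    · ext v
      rw [hsupp A hA, hsupp B hB]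
      simp [hadj]
    · ext a b
      exact hadj a b

/-- If `F` has a vertex of degree at least two, then a matching is an `F`-free graph. -/
theorem mexValues_nonempty {V W : Type*} (m : ℕ) (H : SimpleGraph V) (F : SimpleGraph W)
    {a b c : W} (hab : F.Adj a b) (hac : F.Adj a c) (hbc : b ≠ c) :
    (mexValues m H F).Nonempty := by
  classical
  let M : SimpleGraph (Fin m × Bool) :=
    { Adj := fun x y => x.1 = y.1 ∧ x.2 ≠ y.2
      symm := ⟨fun x y h => ⟨h.1.symm, h.2.symm⟩⟩
      loopless := ⟨fun x h => h.2 rfl⟩ }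
  have hfree : F.Free M := by
    rintro ⟨f⟩
    obtain ⟨h1, h2⟩ : (f a).1 = (f b).1 ∧ (f a).2 ≠ (f b).2 := f.toHom.map_adj hab
    obtain ⟨h3, h4⟩ : (f a).1 = (f c).1 ∧ (f a).2 ≠ (f c).2 := f.toHom.map_adj hac
    refine hbc (f.injective (Prod.ext (h1.symm.trans h3) ?_))
    revert h2 h4
    cases (f a).2 <;> cases (f b).2 <;> cases (f c).2 <;> simp
  have hcard : M.edgeSet.ncard = m := by
    have : M.edgeSet = Set.range (fun i : Fin m => s((i, false), (i, true))) := by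
      ext e
      induction e with
      | _ x y =>
        obtain ⟨i, p⟩ := x
        obtain ⟨j, q⟩ := y
        simp only [SimpleGraph.mem_edgeSet, Set.mem_range, M]
        cases p <;> cases q <;> simp [eq_comm]
    rw [this, ← Set.image_univ, Set.ncard_image_of_injective, Set.ncard_univ]
    · simp
    · intro i j h
      simpa using h
  let e := M.overFinIso rfl
  refine ⟨_, _, M.overFin rfl, (SimpleGraph.free_congr_right e).1 hfree, ?_, rfl⟩
  refine Eq.trans ?_ hcard
  rw [← Nat.card_coe_set_eq, ← Nat.card_coe_set_eq]
  exact (Nat.card_congr e.mapEdgeSet).symm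

/-- For cliques `K_r` with `r ≥ 2` and `F = K_s ∨ C_l` with `s ≥ 1`, `l ≥ 2`, the supremum that
defines `mex` is an attained maximum. -/
theorem mex_isGreatest (m r s l : ℕ) (hr : 2 ≤ r) (hs : 1 ≤ s) (hl : 2 ≤ l) :
    IsGreatest
      (mexValues m (SimpleGraph.completeGraph (Fin r))
        (graphJoin (SimpleGraph.completeGraph (Fin s)) (SimpleGraph.cycleGraph l)))
      (mex m (SimpleGraph.completeGraph (Fin r))
        (graphJoin (SimpleGraph.completeGraph (Fin s)) (SimpleGraph.cycleGraph l))) := by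
  have hb := mexValues_bddAbove m (SimpleGraph.completeGraph (Fin r))
    (graphJoin (SimpleGraph.completeGraph (Fin s)) (SimpleGraph.cycleGraph l)) (by
      intro v
      have : Nontrivial (Fin r) := Fin.nontrivial_iff_two_le.2 hr
      obtain ⟨w, hw⟩ := exists_ne v
      exact ⟨w, hw.symm⟩)
  refine ⟨Nat.sSup_mem ?_ hb, fun k hk => le_csSup hb hk⟩
  exact mexValues_nonempty m _ _ (a := Sum.inl ⟨0, hs⟩) (b := Sum.inr ⟨0, by omega⟩)
    (c := Sum.inr ⟨1, hl⟩) (by simp [graphJoin, completeBipartiteGraph])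
    (by simp [graphJoin, completeBipartiteGraph]) (by simp)

/-!
The exponents come from counting every `r`-clique at one of its vertices `v` of least degree. The
rest of the clique then lies in the set `upNbr G v` of neighbours of no smaller degree, which has at
most `D = √(2 * m)` elements, while the sizes of these sets add up to at most `2 * m = D ^ 2`
(`cliqueCount_univ_le`). With the trivial bound `|S| ^ (r - 1)` for the cliques inside
`S = upNbr G v` this gives `O(m ^ (r / 2))`, the upper bound of the second part. The matching lower
bound holds because in the second part `K_s ∨ C_l` is not `r`-colourable, so that any subgraph of a
complete `r`-partite graph is admissible; one with exactly `m` edges and parts of size about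
`√m / r` completely joined is obtained by adding edges (`rpow_le_mex`).

For the first part, `s - 1` further vertices of the clique are split off, each at the cost of a
factor `D` (`JoinFreeOn.cliqueCount_le`). What remains are the cliques on `r - s` vertices in a set
of at most `D` vertices that spans no `C_l`, and the claim becomes that a graph on `n` vertices
without `C_l` has `O(n ^ (1 + 1 / t))` cliques of size `j ≥ 2` (for `l = 2 * t`) or `j ≥ 3`
(for `l = 2 * t + 1`), see `cliqueCount_le_rpow_of_cycFreeOn`. Neighbourhoods in such a graph
contain no path on `l - 1` vertices, hence are degenerate, and the number of cliques is at most a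
constant times the number of edges, or of edges that lie in triangles. In the odd case a random set
`A` keeps a positive proportion of the latter as edges inside `A` with a triangle apex outside `A`,
and these contain no `C_{2t}`. So both cases reduce to the Bondy–Simonovits theorem
`card_adj_pairs_le_of_cycFreeOn`.

That theorem is proved by breadth-first search: in a graph of large minimum degree the distance
levels around a vertex have to grow, provided that level `i < t` spans few edges with itself and
with level `i + 1` (`IsParent.card_edges_le`). Colour the vertices of level `i` by their ancestor in
an upper level. If many edges lead to vertices that see several colours, a greedily built path has
ends of different colours and any prescribed even length, and it closes through the tree to a cycle
of length exactly `2 * t`. Hence few edges need be dropped to make all neighbours of each vertex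
share their ancestor; descending one level at a time, all neighbours finally coincide.
-/

open Finset SimpleGraph

/-! ### Cycles and alternating paths as sequences of vertices -/

/-- The first `l` terms of `f` are the vertices, in cyclic order, of a cycle of length `l` in `G`.
Terms of `f` from index `l` on are irrelevant. -/
def IsCyc {V : Type*} (G : SimpleGraph V) (l : ℕ) (f : ℕ → V) : Prop :=
  (∀ i < l, ∀ j < l, f i = f j → i = j) ∧ (∀ i, i + 1 < l → G.Adj (f i) (f (i + 1))) ∧
    G.Adj (f (l - 1)) (f 0)

/-- `f 0, …, f (2 * q)` are distinct, the terms with even index lie in `A`, those with odd index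
lie in `B`, and `R` relates each even term to its odd neighbours. The sets `A` and `B` may
overlap. -/
def IsAltPath {V : Type*} (R : V → V → Prop) (A B : Finset V) (q : ℕ) (f : ℕ → V) : Prop :=
  (∀ i ≤ 2 * q, ∀ j ≤ 2 * q, f i = f j → i = j) ∧ (∀ i ≤ q, f (2 * i) ∈ A) ∧
    ∀ i < q, f (2 * i + 1) ∈ B ∧ R (f (2 * i)) (f (2 * i + 1)) ∧ R (f (2 * i + 2)) (f (2 * i + 1))

lemma exists_notMem_image_range {V : Type*} [DecidableEq V] {S : Finset V} (f : ℕ → V) {n : ℕ}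
    (h : n < #S) : ∃ v ∈ S, ∀ i < n, f i ≠ v := by
  obtain ⟨v, hv, hv'⟩ := exists_mem_notMem_of_card_lt_card
    ((card_image_le (s := range n) (f := f)).trans_lt (by simpa using h))
  exact ⟨v, hv, fun i hi hiv => hv' (mem_image.2 ⟨i, mem_range.2 hi, hiv⟩)⟩

open scoped Classical in
/-- Greedy construction of an alternating path whose ends have different colours. -/
lemma exists_isAltPath {V : Type*} (R : V → V → Prop) {κ : Type*} (c : V → κ) (A B : Finset V)
    (D : ℕ) (hA : ∀ a ∈ A, D ≤ #{b ∈ B | R a b})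
    (hB : ∀ b ∈ B, ∀ k, D ≤ #{a ∈ A | R a b ∧ c a ≠ k}) {a₀ : V} (ha₀ : a₀ ∈ A) :
    ∀ q, 2 * q < D → ∃ f, IsAltPath R A B q f ∧ f 0 = a₀ ∧ (q ≠ 0 → c (f 0) ≠ c (f (2 * q))) := by
  intro q
  induction q with
  | zero =>
    intro _
    refine ⟨fun _ => a₀, ⟨?_, ?_, ?_⟩, rfl, by simp⟩
    · intro i hi j hj _; omega
    · intro i _; exact ha₀
    · intro i hi; omega
  | succ q ih =>
    intro hD
    obtain ⟨f, ⟨hinj, hfA, hfR⟩, hf0, -⟩ := ih (by omega)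
    obtain ⟨b, hb, hbf⟩ := exists_notMem_image_range f (n := 2 * q + 1)
      (lt_of_lt_of_le (by omega) (hA _ (hfA q le_rfl)))
    rw [mem_filter] at hb
    obtain ⟨a, ha, haf⟩ := exists_notMem_image_range (fun n => if n ≤ 2 * q then f n else b)
      (n := 2 * q + 2) (lt_of_lt_of_le (by omega) (hB b hb.1 (c a₀)))
    rw [mem_filter] at ha
    have hab : b ≠ a := by simpa using haf (2 * q + 1) (by omega)
    have haf' : ∀ i < 2 * q + 1, f i ≠ a := fun i hi => by
      simpa [show i ≤ 2 * q by omega] using haf i (by omega)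
    refine ⟨fun n => if n ≤ 2 * q then f n else if n = 2 * q + 1 then b else a, ⟨?_, ?_, ?_⟩, ?_, ?_⟩
    · have key : ∀ i j, i < j → j ≤ 2 * (q + 1) →
          (if i ≤ 2 * q then f i else if i = 2 * q + 1 then b else a) ≠
          (if j ≤ 2 * q then f j else if j = 2 * q + 1 then b else a) := by
        intro i j hij hj
        split_ifs <;> first
          | omega
          | exact hab
          | exact hbf i (by omega)
          | exact haf' i (by omega)
          | exact fun h => by have := hinj i (by omega) j (by omega) h; omega
      intro i hi j hj h
      rcases lt_trichotomy i j with hlt | heq | hlt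
      · exact absurd h (key i j hlt hj)
      · exact heq
      · exact absurd h.symm (key j i hlt hi)
    · intro i hi
      dsimp only
      split_ifs
      · exact hfA i (by omega)
      · omega
      · exact ha.1
    · intro i hi
      dsimp only
      by_cases hiq : i < q
      · rw [if_pos (by omega), if_pos (by omega), if_pos (by omega)]
        exact hfR i hiq
      · obtain rfl : i = q := by omega
        rw [if_neg (by omega), if_pos (by omega), if_pos (by omega), if_neg (by omega),
          if_neg (by omega)]
        exact ⟨hb.1, hb.2, ha.2.1⟩
    · simpa using hf0
    · intro _
      dsimp only
      rw [if_pos (by omega), if_neg (by omega), if_neg (by omega), hf0]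
      exact ha.2.2.symm

open scoped Classical in
/-- If no alternating path of length `2 * q` has ends of different colours, then, apart from few
exceptional pairs, each `b ∈ B` is related to vertices of a single colour `g b` only. Vertices of
`A` with few relations, and vertices of `B` that are almost monochromatic, are removed one at a
time; what cannot be reduced further contains the forbidden path. -/
lemma exists_majority_colour {V κ : Type*} (R : V → V → Prop) (c : V → κ) (q : ℕ) (hq : q ≠ 0)
    (g₀ : V → κ) (A B : Finset V) (h : ∀ f, IsAltPath R A B q f → c (f 0) = c (f (2 * q))) :
    ∃ g : V → κ, #{x ∈ A ×ˢ B | R x.1 x.2 ∧ c x.1 ≠ g x.2} ≤ (2 * q + 1) * (#A + #B) := by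
  induction hn : #A + #B generalizing A B with
  | zero =>
    refine ⟨g₀, ?_⟩
    have : A = ∅ := by rw [← card_eq_zero]; omega
    simp [this]
  | succ n ih =>
    by_cases hA : ∃ a ∈ A, #{b ∈ B | R a b} < 2 * q + 1
    · obtain ⟨a, ha, had⟩ := hA
      obtain ⟨g, hg⟩ := ih (A.erase a) B (fun f hf => h f
        ⟨hf.1, fun i hi => mem_of_mem_erase (hf.2.1 i hi), hf.2.2⟩)
        (by have := card_erase_add_one ha; omega)
      refine ⟨g, ?_⟩
      have hsub : {x ∈ A ×ˢ B | R x.1 x.2 ∧ c x.1 ≠ g x.2} ⊆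
          {x ∈ A.erase a ×ˢ B | R x.1 x.2 ∧ c x.1 ≠ g x.2} ∪
            ({b ∈ B | R a b}).image (fun b => (a, b)) := by
        rintro ⟨u, v⟩ hx
        simp only [mem_filter, mem_product, mem_union, mem_image, mem_erase, Prod.mk.injEq] at hx ⊢
        by_cases hu : u = a
        · right; exact ⟨v, ⟨hx.1.2, hu ▸ hx.2.1⟩, hu.symm, rfl⟩
        · left; exact ⟨⟨⟨hu, hx.1.1⟩, hx.1.2⟩, hx.2⟩
      have h1 := (card_le_card hsub).trans (card_union_le _ _)
      have h2 := card_image_le (s := {b ∈ B | R a b}) (f := fun b => (a, b))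
      have h3 : (2 * q + 1) * (n + 1) = (2 * q + 1) * n + (2 * q + 1) := by ring
      omega
    by_cases hB : ∃ b ∈ B, ∃ k, #{a ∈ A | R a b ∧ c a ≠ k} < 2 * q + 1
    · obtain ⟨b, hb, k, hbk⟩ := hB
      obtain ⟨g, hg⟩ := ih A (B.erase b) (fun f hf => h f
        ⟨hf.1, hf.2.1, fun i hi => ⟨mem_of_mem_erase (hf.2.2 i hi).1, (hf.2.2 i hi).2⟩⟩)
        (by have := card_erase_add_one hb; omega)
      refine ⟨Function.update g b k, ?_⟩
      have hsub : {x ∈ A ×ˢ B | R x.1 x.2 ∧ c x.1 ≠ Function.update g b k x.2} ⊆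
          {x ∈ A ×ˢ B.erase b | R x.1 x.2 ∧ c x.1 ≠ g x.2} ∪
            ({a ∈ A | R a b ∧ c a ≠ k}).image (fun a => (a, b)) := by
        rintro ⟨u, v⟩ hx
        simp only [mem_filter, mem_product, mem_union, mem_image, mem_erase, Prod.mk.injEq] at hx ⊢
        by_cases hv : v = b
        · subst hv
          right
          exact ⟨u, ⟨hx.1.1, hx.2.1, by simpa using hx.2.2⟩, rfl, rfl⟩
        · left
          exact ⟨⟨hx.1.1, hv, hx.1.2⟩, hx.2.1, by simpa [hv] using hx.2.2⟩
      have h1 := (card_le_card hsub).trans (card_union_le _ _)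
      have h2 := card_image_le (s := {a ∈ A | R a b ∧ c a ≠ k}) (f := fun a => (a, b))
      have h3 : (2 * q + 1) * (n + 1) = (2 * q + 1) * n + (2 * q + 1) := by ring
      omega
    push Not at hA hB
    exfalso
    have hAne : A.Nonempty := by
      by_contra hAe
      rw [not_nonempty_iff_eq_empty] at hAe
      subst hAe
      obtain ⟨b, hb⟩ : B.Nonempty := by
        rw [← card_pos]; simp at hn; omega
      have := hB b hb (c b)
      simp at this
    obtain ⟨a, ha⟩ := hAne
    obtain ⟨f, hf, -, hne⟩ := exists_isAltPath R c A B (2 * q + 1) hA hB ha q (by omega)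
    exact hne hq (h f hf)

/-! ### The number of edges between consecutive distance levels -/

/-- `p` maps every vertex whose level is a positive natural number to a neighbour of it one level
below. The level `⊤` is meant for vertices that are not reachable from the root. -/
def IsParent {V : Type*} (G : SimpleGraph V) (lev : V → ℕ∞) (p : V → V) : Prop :=
  ∀ (v : V) (j : ℕ), lev v = (j + 1 : ℕ) → lev (p v) = (j : ℕ) ∧ G.Adj v (p v)

lemma IsParent.lev_iterate {V : Type*} {G : SimpleGraph V} {lev : V → ℕ∞} {p : V → V}
    (hp : IsParent G lev p) {v : V} {i : ℕ} (hv : lev v = i) :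
    ∀ j ≤ i, lev (p^[j] v) = (i - j : ℕ) := by
  intro j
  induction j with
  | zero => intro _; simpa using hv
  | succ j ih =>
    intro hj
    rw [Function.iterate_succ_apply']
    exact (hp _ (i - (j + 1)) (by rw [ih (by omega)]; congr 1; omega)).1

lemma IsParent.adj_iterate {V : Type*} {G : SimpleGraph V} {lev : V → ℕ∞} {p : V → V}
    (hp : IsParent G lev p) {v : V} {i : ℕ} (hv : lev v = i) {j : ℕ} (hj : j < i) :
    G.Adj (p^[j] v) (p^[j + 1] v) := by
  rw [Function.iterate_succ_apply']
  exact (hp _ (i - (j + 1)) (by rw [hp.lev_iterate hv j hj.le]; congr 1; omega)).2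

/-- An alternating path between level `i` and vertices of level at least `i`, whose ends have
ancestors that first agree `h + 1` levels above, closes up to a cycle through the tree. -/
lemma IsParent.exists_isCyc {V : Type*} {G : SimpleGraph V} {lev : V → ℕ∞} {p : V → V}
    (hp : IsParent G lev p) {R : V → V → Prop} {A B : Finset V} {i : ℕ}
    (hA : ∀ a ∈ A, lev a = i) (hB : ∀ b ∈ B, (i : ℕ∞) ≤ lev b) (hR : ∀ a b, R a b → G.Adj a b)
    {q h : ℕ} (hh : h + 1 ≤ i) {f : ℕ → V} (hf : IsAltPath R A B q f)
    (heq : p^[h + 1] (f 0) = p^[h + 1] (f (2 * q))) (hne : p^[h] (f 0) ≠ p^[h] (f (2 * q))) :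
    ∃ F, IsCyc G (2 * (q + h + 1)) F := by
  obtain ⟨hinj, hfA, hfR⟩ := hf
  have h0 : lev (f 0) = i := hA _ (by simpa using hfA 0 (by omega))
  have h1 : lev (f (2 * q)) = i := hA _ (hfA q le_rfl)
  have hlev : ∀ n ≤ 2 * q, (i : ℕ∞) ≤ lev (f n) := by
    intro n hn
    obtain ⟨k, rfl | rfl⟩ := Nat.even_or_odd' n
    · exact (hA _ (hfA k (by omega))).ge
    · exact hB _ (hfR k (by omega)).1
  have hfadj : ∀ n, n + 1 ≤ 2 * q → G.Adj (f n) (f (n + 1)) := by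
    intro n hn
    obtain ⟨k, rfl | rfl⟩ := Nat.even_or_odd' n
    · exact hR _ _ (hfR k (by omega)).2.1
    · exact (hR _ _ (hfR k (by omega)).2.2).symm
  have hq0 : q ≠ 0 := by rintro rfl; exact hne rfl
  -- along `f`, up the tree from `f (2 * q)` to the common ancestor, and down again to `f 0`
  let F : ℕ → V := fun n => if n ≤ 2 * q then f n else
    if n ≤ 2 * q + h + 1 then p^[n - 2 * q] (f (2 * q)) else p^[2 * q + 2 * h + 2 - n] (f 0)
  have hF1 : ∀ n ≤ 2 * q, F n = f n := fun n hn => if_pos hn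
  have hF2 : ∀ j ≤ h + 1, F (2 * q + j) = p^[j] (f (2 * q)) := by
    intro j hj
    rcases Nat.eq_zero_or_pos j with rfl | hj0
    · exact hF1 _ le_rfl
    · simp only [F]
      rw [if_neg (by omega), if_pos (by omega)]
      congr 1; omega
  have hF3 : ∀ j, 1 ≤ j → j ≤ h + 1 → F (2 * q + 2 * h + 2 - j) = p^[j] (f 0) := by
    intro j hj hj'
    rcases Nat.lt_or_ge j (h + 1) with hlt | hge
    · simp only [F]
      rw [if_neg (by omega), if_neg (by omega)]
      congr 1; omega
    · obtain rfl : j = h + 1 := by omega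
      rw [heq, ← hF2 (h + 1) le_rfl]
      congr 1; omega
  have key : ∀ m n, m < n → n < 2 * (q + h + 1) → F m ≠ F n := by
    intro m n hmn hn hFF
    -- the level of a vertex on the tree part determines its position up to the choice of a branch
    have hup : ∀ a, 2 * q < a → a < 2 * (q + h + 1) →
        ∃ j, 1 ≤ j ∧ j ≤ h + 1 ∧ lev (F a) = (i - j : ℕ) ∧
          ((a = 2 * q + j ∧ F a = p^[j] (f (2 * q))) ∨
            (a = 2 * q + 2 * h + 2 - j ∧ j ≤ h ∧ F a = p^[j] (f 0))) := by
      intro a ha ha'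
      by_cases hc : a ≤ 2 * q + h + 1
      · obtain ⟨j, rfl⟩ : ∃ j, a = 2 * q + j := ⟨a - 2 * q, by omega⟩
        have := hF2 j (by omega)
        refine ⟨j, by omega, by omega, ?_, Or.inl ⟨rfl, this⟩⟩
        rw [this]; exact hp.lev_iterate h1 j (by omega)
      · obtain ⟨j, rfl, hj1, hj2⟩ : ∃ j, a = 2 * q + 2 * h + 2 - j ∧ 1 ≤ j ∧ j ≤ h :=
          ⟨2 * q + 2 * h + 2 - a, by omega, by omega, by omega⟩
        have := hF3 j (by omega) (by omega)
        refine ⟨j, by omega, by omega, ?_, Or.inr ⟨rfl, hj2, this⟩⟩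
        rw [this]; exact hp.lev_iterate h0 j (by omega)
    by_cases hn' : n ≤ 2 * q
    · rw [hF1 m (by omega), hF1 n hn'] at hFF
      have := hinj m (by omega) n hn' hFF
      omega
    obtain ⟨b, hb1, hb2, hb3, hb4⟩ := hup n (by omega) hn
    by_cases hm' : m ≤ 2 * q
    · have := hlev m hm'
      rw [← hF1 m hm', hFF, hb3, Nat.cast_le] at this
      omega
    obtain ⟨a, ha1, ha2, ha3, ha4⟩ := hup m (by omega) (by omega)
    have hab : i - a = i - b := by
      rw [hFF, hb3] at ha3
      exact_mod_cast ha3.symm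
    obtain rfl : a = b := by omega
    rcases ha4 with ⟨ha4, ha5⟩ | ⟨ha4, ha5, ha6⟩
    · rcases hb4 with ⟨hb4, hb5⟩ | ⟨hb4, hb5, hb6⟩
      · omega
      · apply hne
        have : p^[h - a] (p^[a] (f 0)) = p^[h - a] (p^[a] (f (2 * q))) := by
          rw [← hb6, ← ha5, hFF]
        rwa [← Function.iterate_add_apply, ← Function.iterate_add_apply,
          Nat.sub_add_cancel hb5] at this
    · omega
  refine ⟨F, ?_, ?_, ?_⟩
  · intro m hm n hn hFF
    rcases lt_trichotomy m n with hlt | heq | hlt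
    · exact absurd hFF (key m n hlt hn)
    · exact heq
    · exact absurd hFF.symm (key n m hlt hm)
  · intro n hn
    by_cases hc1 : n + 1 ≤ 2 * q
    · rw [hF1 n (by omega), hF1 _ hc1]
      exact hfadj n hc1
    by_cases hc2 : n + 1 ≤ 2 * q + h + 1
    · obtain ⟨j, rfl⟩ : ∃ j, n = 2 * q + j := ⟨n - 2 * q, by omega⟩
      rw [hF2 j (by omega), add_assoc, hF2 (j + 1) (by omega)]
      exact hp.adj_iterate h1 (by omega)
    · obtain ⟨j, rfl, hj1, hj2⟩ : ∃ j, n = 2 * q + 2 * h + 2 - (j + 1) ∧ 1 ≤ j ∧ j ≤ h :=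
        ⟨2 * q + 2 * h + 1 - n, by omega, by omega, by omega⟩
      rw [hF3 (j + 1) (by omega) (by omega),
        show 2 * q + 2 * h + 2 - (j + 1) + 1 = 2 * q + 2 * h + 2 - j by omega,
        hF3 j hj1 (by omega)]
      exact (hp.adj_iterate h0 (by omega)).symm
  · rw [show 2 * (q + h + 1) - 1 = 2 * q + 2 * h + 2 - 1 by omega, hF3 1 le_rfl (by omega),
      hF1 0 (by omega)]
    exact (hp.adj_iterate h0 (j := 0) (by omega)).symm

open scoped Classical in
/-- In a graph without cycles of length `2 * t`, level `i < t` spans few edges with the vertices of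
any set `B` of level at least `i`. Starting from the root, the ancestor in successive levels of the
neighbours of `b ∈ B` in level `i` is forced, at the expense of few edges at each level. -/
lemma IsParent.card_edges_le {V : Type*} {G : SimpleGraph V} {lev : V → ℕ∞} {p : V → V}
    (hp : IsParent G lev p) {t : ℕ} (hG : ∀ f, ¬ IsCyc G (2 * t) f) {x : V}
    (hx : ∀ v, lev v = 0 → v = x) {A B : Finset V} {i : ℕ} (hi : i < t)
    (hA : ∀ a ∈ A, lev a = i) (hB : ∀ b ∈ B, (i : ℕ∞) ≤ lev b) :
    #{e ∈ A ×ˢ B | G.Adj e.1 e.2} ≤ (2 * t * t + 1) * (#A + #B) := by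
  have main : ∀ k ≤ i, ∃ g : V → V,
      #{e ∈ A ×ˢ B | G.Adj e.1 e.2 ∧ p^[i - k] e.1 ≠ g e.2} ≤ k * (2 * t) * (#A + #B) := by
    intro k
    induction k with
    | zero =>
      intro _
      refine ⟨fun _ => x, ?_⟩
      rw [Nat.zero_mul, Nat.zero_mul, Nat.le_zero, card_eq_zero, filter_eq_empty_iff]
      rintro ⟨a, b⟩ hab ⟨-, hne⟩
      refine hne (hx _ ?_)
      simpa using hp.lev_iterate (hA a (mem_product.1 hab).1) i le_rfl
    | succ k ih =>
      intro hk
      obtain ⟨g, hg⟩ := ih (by omega)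
      -- the path has length `2 * (t - 1 - h)`, so that closing it through an ancestor `h + 1` levels
      -- up gives a cycle of length `2 * t`
      obtain ⟨h, hh⟩ : ∃ h, i = h + k + 1 := ⟨i - k - 1, by omega⟩
      have e1 : i - k = h + 1 := by omega
      have e2 : i - (k + 1) = h := by omega
      rw [e1] at hg
      rw [e2]
      obtain ⟨g', hg'⟩ := exists_majority_colour
        (fun a b => G.Adj a b ∧ p^[h + 1] a = g b) (p^[h]) (t - 1 - h) (by omega) id A B (by
          intro f hf
          by_contra hne
          have hconst : ∀ j ≤ t - 1 - h, p^[h + 1] (f 0) = p^[h + 1] (f (2 * j)) := by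
            intro j
            induction j with
            | zero => intro _; rfl
            | succ j ihj =>
              intro hj
              rw [ihj (by omega), (hf.2.2 j (by omega)).2.1.2,
                show 2 * (j + 1) = 2 * j + 2 by ring, (hf.2.2 j (by omega)).2.2.2]
          obtain ⟨F, hF⟩ := hp.exists_isCyc hA hB (fun a b hab => hab.1) (by omega) hf
            (hconst _ le_rfl) hne
          rw [show t - 1 - h + h + 1 = t by omega] at hF
          exact hG F hF)
      refine ⟨g', ?_⟩
      have hsub : {e ∈ A ×ˢ B | G.Adj e.1 e.2 ∧ p^[h] e.1 ≠ g' e.2} ⊆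
          {e ∈ A ×ˢ B | G.Adj e.1 e.2 ∧ p^[h + 1] e.1 ≠ g e.2} ∪
          {e ∈ A ×ˢ B | (G.Adj e.1 e.2 ∧ p^[h + 1] e.1 = g e.2) ∧ p^[h] e.1 ≠ g' e.2} := by
        intro e he
        simp only [mem_filter, mem_union] at he ⊢
        tauto
      have hc := (card_le_card hsub).trans (card_union_le _ _)
      have hg'' : #{e ∈ A ×ˢ B | (G.Adj e.1 e.2 ∧ p^[h + 1] e.1 = g e.2) ∧ p^[h] e.1 ≠ g' e.2} ≤
          (2 * (t - 1 - h) + 1) * (#A + #B) := by convert hg'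
      have hq : (2 * (t - 1 - h) + 1) * (#A + #B) ≤ 2 * t * (#A + #B) :=
        Nat.mul_le_mul_right _ (by omega)
      have hr : (k + 1) * (2 * t) * (#A + #B)
          = k * (2 * t) * (#A + #B) + 2 * t * (#A + #B) := by ring
      omega
  -- with the ancestor in level `i` itself prescribed, each `b` keeps at most one neighbour
  obtain ⟨g, hg⟩ := main i le_rfl
  simp only [Nat.sub_self, Function.iterate_zero, id_eq] at hg
  have hsub : {e ∈ A ×ˢ B | G.Adj e.1 e.2} ⊆
      {e ∈ A ×ˢ B | G.Adj e.1 e.2 ∧ e.1 ≠ g e.2} ∪ B.image (fun b => (g b, b)) := by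
    rintro ⟨a, b⟩ he
    simp only [mem_filter, mem_union, mem_product, mem_image, Prod.mk.injEq] at he ⊢
    by_cases hab : a = g b
    · exact Or.inr ⟨b, he.1.2, hab.symm, rfl⟩
    · exact Or.inl ⟨he.1, he.2, hab⟩
  have hc := (card_le_card hsub).trans (card_union_le _ _)
  have him := card_image_le (s := B) (f := fun b => (g b, b))
  have hit : i * (2 * t) * (#A + #B) ≤ 2 * t * t * (#A + #B) :=
    Nat.mul_le_mul_right _ (by nlinarith)
  rw [add_mul]
  omega

/-! ### The Bondy–Simonovits theorem -/

/-- The subgraph of `G` induced by `S` contains no cycle of length `l`. -/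
def CycFreeOn {V : Type*} (G : SimpleGraph V) (l : ℕ) (S : Finset V) : Prop :=
  ∀ f, IsCyc G l f → ∃ i < l, f i ∉ S

lemma CycFreeOn.mono {V : Type*} {G : SimpleGraph V} {l : ℕ} {S T : Finset V}
    (h : CycFreeOn G l T) (hST : S ⊆ T) : CycFreeOn G l S := fun f hf =>
  let ⟨i, hi, hif⟩ := h f hf
  ⟨i, hi, fun hS => hif (hST hS)⟩

lemma exists_adj_edist_eq {V : Type*} {G : SimpleGraph V} {x v : V} {j : ℕ}
    (h : G.edist x v = (j + 1 : ℕ)) : ∃ u, G.edist x u = (j : ℕ) ∧ G.Adj v u := by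
  rw [edist_comm] at h
  obtain ⟨w, hw⟩ := exists_walk_of_edist_eq_coe h
  cases w with
  | nil => simp at hw
  | @cons _ u _ hvu w' =>
    refine ⟨u, le_antisymm ?_ ?_, hvu⟩
    · rw [edist_comm]
      refine (edist_le w').trans ?_
      rw [Walk.length_cons] at hw
      exact_mod_cast (by omega : w'.length ≤ j)
    · have := G.edist_triangle (u := v) (v := u) (w := x)
      rw [h, edist_eq_one_iff_adj.2 hvu, edist_comm (u := u)] at this
      by_contra hlt
      push Not at hlt
      lift G.edist x u to ℕ using (ne_top_of_lt hlt) with d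
      norm_cast at this hlt
      omega

lemma edist_le_add_one_of_adj {V : Type*} {G : SimpleGraph V} {x u v : V} (h : G.Adj u v) :
    G.edist x v ≤ G.edist x u + 1 :=
  (edist_eq_one_iff_adj.2 h) ▸ G.edist_triangle

open scoped Classical in
/-- Large minimum degree in a graph without `2 * t`-cycles makes the distance levels around a
vertex grow by the factor `q` at each of the first `t` steps. -/
lemma pow_le_card_of_cycFreeOn {V : Type*} {G : SimpleGraph V} {S : Finset V} {t q : ℕ}
    (hG : CycFreeOn G (2 * t) S) (hq : 1 ≤ q) (hS : S.Nonempty)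
    (hdeg : ∀ v ∈ S, 6 * (2 * t * t + 1) * q ≤ #{w ∈ S | G.Adj v w}) : q ^ t ≤ #S := by
  obtain ⟨x, hxS⟩ := hS
  obtain ⟨H, hHadj⟩ : ∃ H : SimpleGraph V, ∀ u v, H.Adj u v ↔ G.Adj u v ∧ u ∈ S ∧ v ∈ S :=
    ⟨{ Adj := fun u v => G.Adj u v ∧ u ∈ S ∧ v ∈ S
       symm := ⟨fun u v h => ⟨h.1.symm, h.2.2, h.2.1⟩⟩
       loopless := ⟨fun u h => h.1.ne rfl⟩ }, fun u v => Iff.rfl⟩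
  have hH : ∀ f, ¬ IsCyc H (2 * t) f := by
    rintro f ⟨hinj, hadj, hlast⟩
    simp only [hHadj] at hadj hlast
    obtain ⟨i, hi, hiS⟩ := hG f ⟨hinj, fun i hi => (hadj i hi).1, hlast.1⟩
    by_cases h : i + 1 < 2 * t
    · exact hiS (hadj i h).2.1
    · rw [show i = 2 * t - 1 by omega] at hiS
      exact hiS hlast.2.1
  have hpar : ∀ v, ∃ u, ∀ j : ℕ, H.edist x v = (j + 1 : ℕ) →
      H.edist x u = (j : ℕ) ∧ H.Adj v u := by
    intro v
    by_cases h : ∃ j : ℕ, H.edist x v = (j + 1 : ℕ)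
    · obtain ⟨j, hj⟩ := h
      obtain ⟨u, hu⟩ := exists_adj_edist_eq hj
      refine ⟨u, fun k hk => ?_⟩
      obtain rfl : k = j := by
        rw [hj] at hk
        have : j + 1 = k + 1 := by exact_mod_cast hk
        omega
      exact hu
    · exact ⟨v, fun j hj => absurd ⟨j, hj⟩ h⟩
  choose p hp using hpar
  have hp : IsParent H (fun v => H.edist x v) p := hp
  obtain ⟨L, hL⟩ : ∃ L : ℕ → Finset V, ∀ i v, v ∈ L i ↔ v ∈ S ∧ H.edist x v = (i : ℕ) :=
    ⟨fun i => {v ∈ S | H.edist x v = (i : ℕ)}, fun i v => by simp⟩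
  have hx : ∀ v, H.edist x v = 0 → v = x := fun v hv => (edist_eq_zero_iff.1 hv).symm
  set C := 2 * t * t + 1 with hC
  -- `P` is the previous level, which is empty for `i = 0`
  have grow : ∀ i < t, ∀ P : Finset V, #P ≤ #(L i) →
      (∀ a ∈ L i, ∀ b ∈ S, G.Adj a b → b ∈ P ∨ b ∈ L i ∪ L (i + 1)) →
      #{e ∈ P ×ˢ L i | H.Adj e.1 e.2} ≤ C * (#P + #(L i)) → #(L i) * q ≤ #(L (i + 1)) := by
    intro i hi P hP hnbr hback
    have h1 : #{e ∈ L i ×ˢ (L i ∪ L (i + 1)) | H.Adj e.1 e.2} ≤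
        C * (#(L i) + #(L i ∪ L (i + 1))) := by
      refine hp.card_edges_le hH hx hi (fun a ha => ((hL _ _).1 ha).2) (fun b hb => ?_)
      rcases mem_union.1 hb with hb | hb
      · exact ((hL _ _).1 hb).2.ge
      · rw [((hL _ _).1 hb).2]; exact_mod_cast Nat.le_succ i
    have h2 : #(L i) * (6 * C * q) ≤ #{e ∈ L i ×ˢ S | G.Adj e.1 e.2} := by
      rw [card_filter, sum_product, ← smul_eq_mul]
      refine card_nsmul_le_sum _ _ _ (fun a ha => ?_)
      rw [← card_filter]
      exact hdeg a ((hL _ _).1 ha).1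
    have hsub : {e ∈ L i ×ˢ S | G.Adj e.1 e.2} ⊆
        {e ∈ L i ×ˢ (L i ∪ L (i + 1)) | H.Adj e.1 e.2} ∪
          ({e ∈ P ×ˢ L i | H.Adj e.1 e.2}).image Prod.swap := by
      rintro ⟨a, b⟩ he
      simp only [mem_filter, mem_product] at he
      obtain ⟨⟨ha, hb⟩, hab⟩ := he
      have haS := ((hL _ _).1 ha).1
      rw [mem_union]
      rcases hnbr a ha b hb hab with h | h
      · right
        exact mem_image.2 ⟨(b, a), mem_filter.2 ⟨mem_product.2 ⟨h, ha⟩,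
          (hHadj _ _).2 ⟨hab.symm, hb, haS⟩⟩, rfl⟩
      · left
        exact mem_filter.2 ⟨mem_product.2 ⟨ha, h⟩, (hHadj _ _).2 ⟨hab, haS, hb⟩⟩
    have h3 := (card_le_card hsub).trans (card_union_le _ _)
    have h4 := card_image_le (s := {e ∈ P ×ˢ L i | H.Adj e.1 e.2}) (f := Prod.swap)
    have h5 := card_union_le (L i) (L (i + 1))
    have h6 : C * (6 * (#(L i) * q)) ≤ C * (5 * #(L i) + #(L (i + 1))) := by
      calc C * (6 * (#(L i) * q)) = #(L i) * (6 * C * q) := by ring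
        _ ≤ C * (#(L i) + #(L i ∪ L (i + 1))) + C * (#P + #(L i)) := by omega
        _ = C * (#(L i) + #(L i ∪ L (i + 1)) + (#P + #(L i))) := by ring
        _ ≤ _ := Nat.mul_le_mul_left _ (by omega)
    have h7 := Nat.le_of_mul_le_mul_left h6 (by omega)
    have h8 : #(L i) ≤ #(L i) * q := Nat.le_mul_of_pos_right _ hq
    omega
  have hnbr : ∀ i a b (P : Finset V), a ∈ L i → b ∈ S → G.Adj a b →
      (∀ j, j + 1 = i → b ∈ L j → b ∈ P) → b ∈ P ∨ b ∈ L i ∪ L (i + 1) := by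
    intro i a b P ha hb hab hP
    have ha' := (hL _ _).1 ha
    have hHab : H.Adj a b := (hHadj _ _).2 ⟨hab, ha'.1, hb⟩
    have h1 := edist_le_add_one_of_adj (x := x) hHab
    have h2 := edist_le_add_one_of_adj (x := x) hHab.symm
    rw [ha'.2] at h1 h2
    have hne : H.edist x b ≠ ⊤ := ne_top_of_le_ne_top (by simp) h1
    lift H.edist x b to ℕ using hne with d hd
    norm_cast at h1 h2
    obtain h | h | h : d + 1 = i ∨ d = i ∨ d = i + 1 := by omega
    · exact Or.inl (hP d h ((hL _ _).2 ⟨hb, hd.symm⟩))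
    · exact Or.inr (mem_union_left _ ((hL _ _).2 ⟨hb, by rw [← hd, h]⟩))
    · exact Or.inr (mem_union_right _ ((hL _ _).2 ⟨hb, by rw [← hd, h]⟩))
  have step : ∀ i < t, #(L i) * q ≤ #(L (i + 1)) := by
    intro i
    induction i with
    | zero =>
      intro ht
      refine grow 0 ht ∅ (by simp) (fun a ha b hb hab => ?_) (by simp)
      exact hnbr 0 a b ∅ ha hb hab (fun j hj => by omega)
    | succ i ih =>
      intro ht
      have hi := ih (by omega)
      refine grow (i + 1) ht (L i) ((Nat.le_mul_of_pos_right _ hq).trans hi)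
        (fun a ha b hb hab => hnbr (i + 1) a b (L i) ha hb hab fun j hj hbj => ?_) ?_
      · obtain rfl : j = i := by omega
        exact hbj
      · refine hp.card_edges_le hH hx (by omega : i < t) (fun a ha => ((hL _ _).1 ha).2)
          (fun b hb => ?_)
        rw [((hL _ _).1 hb).2]; exact_mod_cast Nat.le_succ i
  have hpow : ∀ i ≤ t, q ^ i ≤ #(L i) := by
    intro i
    induction i with
    | zero =>
      intro _
      rw [pow_zero, Nat.one_le_iff_ne_zero, ← Nat.pos_iff_ne_zero, card_pos]
      exact ⟨x, (hL _ _).2 ⟨hxS, by simp⟩⟩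
    | succ i ih =>
      intro hi
      rw [pow_succ]
      exact (Nat.mul_le_mul_right _ (ih (by omega))).trans (step i (by omega))
  exact (hpow t le_rfl).trans (card_le_card fun v hv => ((hL _ _).1 hv).1)

open scoped Classical in
lemma card_adj_pairs_le_of_degenerate {V : Type*} (G : SimpleGraph V) (d : ℕ) (S : Finset V)
    (h : ∀ T ⊆ S, T.Nonempty → ∃ v ∈ T, #{w ∈ T | G.Adj v w} ≤ d) :
    #{e ∈ S ×ˢ S | G.Adj e.1 e.2} ≤ 2 * d * #S := by
  induction S using Finset.strongInduction with
  | H S ih =>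
    rcases S.eq_empty_or_nonempty with rfl | hS
    · simp
    obtain ⟨v, hv, hvd⟩ := h S subset_rfl hS
    have hI := ih (S.erase v) (erase_ssubset hv)
      (fun T hT => h T (hT.trans (erase_subset _ _)))
    have hsub : {e ∈ S ×ˢ S | G.Adj e.1 e.2} ⊆
        {e ∈ S.erase v ×ˢ S.erase v | G.Adj e.1 e.2} ∪
          (({w ∈ S | G.Adj v w}).image (fun w => (v, w)) ∪
            ({w ∈ S | G.Adj v w}).image (fun w => (w, v))) := by
      rintro ⟨a, b⟩ he
      simp only [mem_filter, mem_product, mem_union, mem_image, mem_erase, Prod.mk.injEq] at he ⊢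
      by_cases ha : a = v
      · exact Or.inr (Or.inl ⟨b, ⟨he.1.2, ha ▸ he.2⟩, ha.symm, rfl⟩)
      by_cases hb : b = v
      · exact Or.inr (Or.inr ⟨a, ⟨he.1.1, hb ▸ he.2.symm⟩, rfl, hb.symm⟩)
      · exact Or.inl ⟨⟨⟨ha, he.1.1⟩, hb, he.1.2⟩, he.2⟩
    have h1 := card_le_card hsub
    have h2 := card_union_le {e ∈ S.erase v ×ˢ S.erase v | G.Adj e.1 e.2}
      (({w ∈ S | G.Adj v w}).image (fun w => (v, w)) ∪
        ({w ∈ S | G.Adj v w}).image (fun w => (w, v)))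
    have h3 := card_union_le (({w ∈ S | G.Adj v w}).image (fun w => (v, w)))
      (({w ∈ S | G.Adj v w}).image (fun w => (w, v)))
    have h4 := card_image_le (s := {w ∈ S | G.Adj v w}) (f := fun w => (v, w))
    have h5 := card_image_le (s := {w ∈ S | G.Adj v w}) (f := fun w => (w, v))
    have h6 := card_erase_add_one hv
    have h7 : 2 * d * #S = 2 * d * #(S.erase v) + 2 * d := by rw [← h6]; ring
    omega

open scoped Classical in
/-- Bondy–Simonovits: a graph on `n` vertices without cycles of length `2 * t` has
`O(n ^ (1 + 1 / t))` edges. Ordered pairs of adjacent vertices are counted. -/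
theorem card_adj_pairs_le_of_cycFreeOn {V : Type*} {G : SimpleGraph V} {S : Finset V} {t : ℕ}
    (ht : t ≠ 0) (hG : CycFreeOn G (2 * t) S) :
    (#{e ∈ S ×ˢ S | G.Adj e.1 e.2} : ℝ) ≤
      24 * (2 * t * t + 1) * (#S : ℝ) ^ (1 + 1 / (t : ℝ)) := by
  rcases S.eq_empty_or_nonempty with rfl | hS
  · simp; positivity
  have hS1 : (1 : ℝ) ≤ #S := by exact_mod_cast hS.card_pos
  set y : ℝ := (#S : ℝ) ^ (1 / (t : ℝ)) with hy
  have hy1 : 1 ≤ y := Real.one_le_rpow hS1 (by positivity)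
  have hyt : y ^ t = #S := by
    rw [hy, one_div, Real.rpow_inv_natCast_pow (by positivity) ht]
  -- the least natural number whose `t`-th power exceeds the number of vertices
  set q := ⌊y⌋₊ + 1 with hq
  have hqy : y < q := by rw [hq]; exact_mod_cast Nat.lt_floor_add_one y
  have hq2 : (q : ℝ) ≤ 2 * y := by
    rw [hq]; push_cast
    linarith [Nat.floor_le (zero_le_one.trans hy1)]
  have hqt : #S < q ^ t := by
    have : y ^ t < (q : ℝ) ^ t := pow_lt_pow_left₀ hqy (by linarith) ht
    rw [hyt] at this
    exact_mod_cast this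
  have hdeg := card_adj_pairs_le_of_degenerate G (6 * (2 * t * t + 1) * q) S (by
    intro T hT hTne
    by_contra hcon
    push Not at hcon
    have := pow_le_card_of_cycFreeOn (hG.mono hT) (by omega : 1 ≤ q) hTne
      (fun v hv => (hcon v hv).le)
    have := card_le_card hT
    omega)
  have hdeg' : (#{e ∈ S ×ˢ S | G.Adj e.1 e.2} : ℝ) ≤
      2 * (6 * (2 * t * t + 1) * q) * #S := by exact_mod_cast hdeg
  have hrw : (#S : ℝ) ^ (1 + 1 / (t : ℝ)) = #S * y := by
    rw [Real.rpow_add (by linarith), Real.rpow_one]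
  rw [hrw]
  calc _ ≤ _ := hdeg'
    _ = 12 * (2 * t * t + 1) * #S * (q : ℝ) := by ring
    _ ≤ 12 * (2 * t * t + 1) * #S * (2 * y) := by gcongr
    _ = _ := by ring

/-! ### Counting cliques inside a set of vertices -/

open scoped Classical in
/-- The number of cliques with `k` vertices, all of them in `S`. -/
noncomputable def cliqueCount {V : Type*} (G : SimpleGraph V) (k : ℕ) (S : Finset V) : ℕ :=
  #{K ∈ S.powerset | G.IsNClique k K}

lemma cliqueCount_le_pow {V : Type*} (G : SimpleGraph V) (k : ℕ) (S : Finset V) :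
    cliqueCount G k S ≤ #S ^ k := by
  classical
  refine le_trans (card_le_card fun K hK => ?_)
    ((card_powersetCard k S).trans_le (Nat.choose_le_pow _ _))
  rw [mem_filter, mem_powerset] at hK
  exact mem_powersetCard.2 ⟨hK.1, hK.2.card_eq⟩

open scoped Classical in
/-- If every `(k + 1)`-clique contained in `S` has a vertex `v` such that the rest of the clique
lies in `N v`, then counting by this vertex bounds the number of cliques. -/
lemma cliqueCount_succ_le_sum {V : Type*} (G : SimpleGraph V) (k : ℕ) (S : Finset V)
    (N : V → Finset V)
    (hN : ∀ K ⊆ S, G.IsNClique (k + 1) K → ∃ v ∈ K, K.erase v ⊆ N v) :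
    cliqueCount G (k + 1) S ≤ ∑ v ∈ S, cliqueCount G k (N v) := by
  have hsub : {K ∈ S.powerset | G.IsNClique (k + 1) K} ⊆
      S.biUnion fun v => ({K ∈ (N v).powerset | G.IsNClique k K}).image (insert v) := by
    intro K hK
    rw [mem_filter, mem_powerset] at hK
    obtain ⟨v, hv, hvN⟩ := hN K hK.1 hK.2
    refine mem_biUnion.2 ⟨v, hK.1 hv, mem_image.2 ⟨K.erase v, ?_, insert_erase hv⟩⟩
    rw [mem_filter, mem_powerset]
    exact ⟨hvN, hK.2.erase_of_mem hv⟩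
  refine (card_le_card hsub).trans (card_biUnion_le.trans (sum_le_sum fun v _ => ?_))
  exact card_image_le

open scoped Classical in
lemma cliqueCount_succ_le_sum_nbr {V : Type*} (G : SimpleGraph V) (k : ℕ) (S : Finset V) :
    cliqueCount G (k + 1) S ≤ ∑ v ∈ S, cliqueCount G k {w ∈ S | G.Adj v w} := by
  refine cliqueCount_succ_le_sum G k S _ fun K hKS hK => ?_
  obtain ⟨v, hv⟩ : K.Nonempty := card_pos.1 (by rw [hK.card_eq]; omega)
  refine ⟨v, hv, fun w hw => ?_⟩
  rw [mem_erase] at hw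
  exact mem_filter.2 ⟨hKS hw.2, hK.isClique (mem_coe.2 hv) (mem_coe.2 hw.2) hw.1.symm⟩

open scoped Classical in
lemma cliqueCount_le_of_degenerate {V : Type*} (G : SimpleGraph V) (d k : ℕ) (S : Finset V)
    (h : ∀ T ⊆ S, T.Nonempty → ∃ v ∈ T, #{w ∈ T | G.Adj v w} ≤ d) :
    cliqueCount G (k + 1) S ≤ #S * d ^ k := by
  induction S using Finset.strongInduction with
  | H S ih =>
    rcases S.eq_empty_or_nonempty with rfl | hS
    · simp [cliqueCount, isNClique_iff]
    obtain ⟨v, hv, hvd⟩ := h S subset_rfl hS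
    have hI := ih (S.erase v) (erase_ssubset hv)
      (fun T hT => h T (hT.trans (erase_subset _ _)))
    have hsub : {K ∈ S.powerset | G.IsNClique (k + 1) K} ⊆
        {K ∈ (S.erase v).powerset | G.IsNClique (k + 1) K} ∪
          ({K ∈ ({w ∈ S | G.Adj v w}).powerset | G.IsNClique k K}).image (insert v) := by
      intro K hK
      simp only [mem_filter, mem_powerset, mem_union, mem_image] at hK ⊢
      obtain ⟨hKS, hKq⟩ := hK
      by_cases hvK : v ∈ K
      · refine Or.inr ⟨K.erase v, ⟨fun w hw => ?_, hKq.erase_of_mem hvK⟩, insert_erase hvK⟩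
        rw [mem_erase] at hw
        exact mem_filter.2 ⟨hKS hw.2, hKq.isClique (mem_coe.2 hvK) (mem_coe.2 hw.2) hw.1.symm⟩
      · exact Or.inl ⟨subset_erase.2 ⟨hKS, hvK⟩, hKq⟩
    have h1 := (card_le_card hsub).trans (card_union_le _ _)
    have h2 := card_image_le (s := {K ∈ ({w ∈ S | G.Adj v w}).powerset | G.IsNClique k K})
      (f := insert v)
    have h3 := (cliqueCount_le_pow G k {w ∈ S | G.Adj v w}).trans (Nat.pow_le_pow_left hvd k)
    have h4 : #S * d ^ k = #(S.erase v) * d ^ k + d ^ k := by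
      rw [← card_erase_add_one hv]; ring
    unfold cliqueCount at hI h3 ⊢
    omega

/-! ### Cliques in graphs without a cycle of given length -/

open scoped Classical in
lemma exists_path_of_lt_degree {V : Type*} {G : SimpleGraph V} {T : Finset V} {d : ℕ}
    (hT : T.Nonempty) (hdeg : ∀ v ∈ T, d < #{w ∈ T | G.Adj v w}) :
    ∀ n < d, ∃ f : ℕ → V, (∀ i ≤ n, f i ∈ T) ∧ (∀ i ≤ n, ∀ j ≤ n, f i = f j → i = j) ∧
      ∀ i < n, G.Adj (f i) (f (i + 1)) := by
  intro n
  induction n with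
  | zero =>
    obtain ⟨v, hv⟩ := hT
    exact fun _ => ⟨fun _ => v, fun _ _ => hv, fun i hi j hj _ => by omega, fun i hi => by omega⟩
  | succ n ih =>
    intro hn
    obtain ⟨f, hfT, hinj, hadj⟩ := ih (by omega)
    obtain ⟨v, hv, hvf⟩ := exists_notMem_image_range f (n := n + 1)
      (hn.trans (hdeg _ (hfT n le_rfl)))
    rw [mem_filter] at hv
    refine ⟨fun i => if i ≤ n then f i else v, fun i hi => ?_, fun i hi j hj => ?_, fun i hi => ?_⟩
    · dsimp only
      split_ifs with h
      · exact hfT i h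
      · exact hv.1
    · dsimp only
      split_ifs with h1 h2 h2
      · exact hinj i h1 j h2
      · exact fun h => absurd h (hvf i (by omega))
      · exact fun h => absurd h.symm (hvf j (by omega))
      · omega
    · dsimp only
      rw [if_pos (by omega)]
      split_ifs with h
      · exact hadj i (by omega)
      · obtain rfl : i = n := by omega
        exact hv.2

/-- A path all of whose vertices differ from `v`, with both ends adjacent to `v`, closes up to a
cycle. -/
lemma isCyc_of_path {V : Type*} {G : SimpleGraph V} {f : ℕ → V} {v : V} {n : ℕ}
    (hinj : ∀ i ≤ n, ∀ j ≤ n, f i = f j → i = j) (hadj : ∀ i < n, G.Adj (f i) (f (i + 1)))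
    (hv : ∀ i ≤ n, f i ≠ v) (h0 : G.Adj v (f 0)) (hn : G.Adj (f n) v) :
    IsCyc G (n + 2) (fun i => if i ≤ n then f i else v) := by
  refine ⟨fun i hi j hj => ?_, fun i hi => ?_, ?_⟩
  · dsimp only
    split_ifs with h1 h2 h2
    · exact hinj i h1 j h2
    · exact fun h => absurd h (hv i h1)
    · exact fun h => absurd h.symm (hv j h2)
    · omega
  · dsimp only
    rw [if_pos (by omega)]
    split_ifs with h
    · exact hadj i (by omega)
    · obtain rfl : i = n := by omega
      exact hn
  · dsimp only
    rw [if_neg (by omega), if_pos (by omega)]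
    exact h0

open scoped Classical in
/-- A neighbourhood in a graph without `l`-cycles contains no path on `l - 1` vertices, so it is
degenerate. -/
lemma CycFreeOn.exists_degree_le {V : Type*} {G : SimpleGraph V} {S : Finset V} {l : ℕ}
    (hl : 2 ≤ l) (hG : CycFreeOn G l S) {v : V} (hv : v ∈ S) (T : Finset V)
    (hT : T ⊆ {w ∈ S | G.Adj v w}) (hne : T.Nonempty) : ∃ u ∈ T, #{w ∈ T | G.Adj u w} ≤ l := by
  by_contra hcon
  push Not at hcon
  obtain ⟨f, hfT, hinj, hadj⟩ := exists_path_of_lt_degree hne hcon (l - 2) (by omega)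
  have hf : ∀ i ≤ l - 2, f i ∈ S ∧ G.Adj v (f i) := fun i hi => mem_filter.1 (hT (hfT i hi))
  have hcyc := isCyc_of_path hinj hadj (v := v) (fun i hi => (hf i hi).2.ne')
    (hf 0 (by omega)).2 (hf _ le_rfl).2.symm
  rw [show l - 2 + 2 = l by omega] at hcyc
  obtain ⟨i, -, hi⟩ := hG _ hcyc
  split_ifs at hi with h
  · exact hi (hf i h).1
  · exact hi hv

open scoped Classical in
lemma cliqueCount_le_of_cycFreeOn {V : Type*} {G : SimpleGraph V} {S : Finset V} {l : ℕ}
    (hl : 2 ≤ l) (hG : CycFreeOn G l S) (k : ℕ) :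
    cliqueCount G (k + 2) S ≤ #{e ∈ S ×ˢ S | G.Adj e.1 e.2} * l ^ k := by
  refine (cliqueCount_succ_le_sum_nbr G (k + 1) S).trans ?_
  rw [card_filter, sum_product, sum_mul]
  refine sum_le_sum fun v hv => ?_
  rw [← card_filter]
  exact cliqueCount_le_of_degenerate G l k _ (hG.exists_degree_le hl hv)

open scoped Classical in
/-- For cliques on at least three vertices only the edges in triangles matter. -/
lemma cliqueCount_le_of_cycFreeOn_triangle {V : Type*} {G : SimpleGraph V} {S : Finset V} {l : ℕ}
    (hl : 2 ≤ l) (hG : CycFreeOn G l S) (k : ℕ) :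
    cliqueCount G (k + 3) S ≤
      #{e ∈ S ×ˢ S | G.Adj e.1 e.2 ∧ ∃ w ∈ S, G.Adj e.1 w ∧ G.Adj e.2 w} * l ^ (k + 1) := by
  refine (cliqueCount_succ_le_sum G (k + 2) S
    (fun v => {u ∈ S | G.Adj v u ∧ ∃ w ∈ S, G.Adj v w ∧ G.Adj u w}) ?_).trans ?_
  · intro K hKS hK
    obtain ⟨v, hv⟩ : K.Nonempty := card_pos.1 (by rw [hK.card_eq]; omega)
    refine ⟨v, hv, fun u hu => ?_⟩
    obtain ⟨w, hw⟩ : ((K.erase v).erase u).Nonempty := card_pos.1 (by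
      rw [((hK.erase_of_mem hv).erase_of_mem hu).card_eq]; omega)
    simp only [mem_erase] at hu hw
    have hadj : ∀ a ∈ K, ∀ b ∈ K, a ≠ b → G.Adj a b := fun a ha b hb hab => hK.isClique ha hb hab
    exact mem_filter.2 ⟨hKS hu.2, hadj v hv u hu.2 hu.1.symm, w, hKS hw.2.2,
      hadj v hv w hw.2.2 hw.2.1.symm, hadj u hu.2 w hw.2.2 hw.1.symm⟩
  rw [card_filter, sum_product, sum_mul]
  refine sum_le_sum fun v hv => ?_
  rw [← card_filter]
  refine cliqueCount_le_of_degenerate G l (k + 1) _ fun T hT => hG.exists_degree_le hl hv T ?_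
  exact hT.trans fun u hu => by
    rw [mem_filter] at hu ⊢
    exact ⟨hu.1, hu.2.1⟩

/-! ### Edges in triangles of graphs without an odd cycle -/

open scoped Classical in
lemma two_pow_le_card_separating {V : Type*} (S : Finset V) {u v w : V} (hu : u ∈ S) (hv : v ∈ S)
    (huw : u ≠ w) (hvw : v ≠ w) :
    2 ^ #S ≤ 8 * #{A ∈ S.powerset | u ∈ A ∧ v ∈ A ∧ w ∉ A} := by
  have hcard : #(univ : Finset (Bool × Bool × Bool)) = 8 := by decide
  rw [← card_powerset, ← hcard, ← card_product]
  -- force `u` and `v` in and `w` out, and remember the three memberships that were overwritten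
  refine card_le_card_of_injOn
    (fun A => ((decide (u ∈ A), decide (v ∈ A), decide (w ∈ A)), insert u (insert v (A.erase w))))
    ?_ ?_
  · intro A hA
    have hA' : A ⊆ S := by simpa using hA
    simp only [coe_product, coe_univ, Set.mem_prod, Set.mem_univ, true_and, mem_coe, mem_filter,
      mem_powerset, mem_insert, mem_erase]
    refine ⟨insert_subset hu (insert_subset hv ((erase_subset _ _).trans hA')), by simp, by simp,
      ?_⟩
    simp [huw.symm, hvw.symm]
  · intro A _ B _ hAB
    simp only [Prod.mk.injEq, decide_eq_decide] at hAB
    obtain ⟨⟨h1, h2, h3⟩, h4⟩ := hAB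
    ext x
    by_cases hxu : x = u
    · rw [hxu, h1]
    by_cases hxv : x = v
    · rw [hxv, h2]
    by_cases hxw : x = w
    · rw [hxw, h3]
    have := congrArg (x ∈ ·) h4
    simpa [hxu, hxv, hxw] using this

open scoped Classical in
/-- A random subset of `S` contains `u` and `v` but not `w` with probability at least `1 / 8`, so
some subset does so for an eighth of any given family of triples. -/
lemma exists_separating_subset {V : Type*} (S : Finset V) (E : Finset (V × V)) (w : V × V → V)
    (hE : ∀ e ∈ E, e.1 ∈ S ∧ e.2 ∈ S ∧ e.1 ≠ w e ∧ e.2 ≠ w e) :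
    ∃ A ⊆ S, #E ≤ 8 * #{e ∈ E | e.1 ∈ A ∧ e.2 ∈ A ∧ w e ∉ A} := by
  have hsum : ∑ _A ∈ S.powerset, #E ≤
      ∑ A ∈ S.powerset, 8 * #{e ∈ E | e.1 ∈ A ∧ e.2 ∈ A ∧ w e ∉ A} := by
    simp only [← mul_sum, card_filter]
    rw [sum_comm, mul_sum, sum_const, card_powerset, smul_eq_mul, mul_comm, ← smul_eq_mul]
    refine card_nsmul_le_sum _ _ _ fun e he => ?_
    obtain ⟨h1, h2, h3, h4⟩ := hE e he
    rw [← card_filter]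
    exact two_pow_le_card_separating S h1 h2 h3 h4
  obtain ⟨A, hA, hAE⟩ := exists_le_of_sum_le (powerset_nonempty S) hsum
  exact ⟨A, mem_powerset.1 hA, hAE⟩

open scoped Classical in
/-- In a graph without cycles of length `2 * t + 1`, the edges inside a set `A` that form a triangle
with a vertex outside `A` contain no cycle of length `2 * t`: one of its edges could be replaced by
the two other sides of the triangle. -/
lemma card_triangle_pairs_le_of_cycFreeOn {V : Type*} {G : SimpleGraph V} {S : Finset V} {t : ℕ}
    (ht : t ≠ 0) (hG : CycFreeOn G (2 * t + 1) S) :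
    (#{e ∈ S ×ˢ S | G.Adj e.1 e.2 ∧ ∃ w ∈ S, G.Adj e.1 w ∧ G.Adj e.2 w} : ℝ) ≤
      192 * (2 * t * t + 1) * (#S : ℝ) ^ (1 + 1 / (t : ℝ)) := by
  set E := {e ∈ S ×ˢ S | G.Adj e.1 e.2 ∧ ∃ w ∈ S, G.Adj e.1 w ∧ G.Adj e.2 w} with hE
  have hw : ∀ e : V × V, ∃ w, e ∈ E → w ∈ S ∧ G.Adj e.1 w ∧ G.Adj e.2 w := by
    intro e
    by_cases he : e ∈ E
    · obtain ⟨w, hw⟩ := (mem_filter.1 he).2.2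
      exact ⟨w, fun _ => hw⟩
    · exact ⟨e.1, fun h => absurd h he⟩
  choose w hw using hw
  obtain ⟨A, -, hA⟩ := exists_separating_subset S E w (fun e he =>
    ⟨(mem_product.1 (mem_filter.1 he).1).1, (mem_product.1 (mem_filter.1 he).1).2,
      (hw e he).2.1.ne, (hw e he).2.2.ne⟩)
  obtain ⟨J, hJ⟩ : ∃ J : SimpleGraph V, ∀ u v, J.Adj u v ↔
      G.Adj u v ∧ u ∈ A ∧ v ∈ A ∧ ∃ x ∈ S, x ∉ A ∧ G.Adj u x ∧ G.Adj v x :=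
    ⟨{ Adj := fun u v => G.Adj u v ∧ u ∈ A ∧ v ∈ A ∧ ∃ x ∈ S, x ∉ A ∧ G.Adj u x ∧ G.Adj v x
       symm := ⟨fun u v ⟨h1, h2, h3, x, h4, h5, h6, h7⟩ => ⟨h1.symm, h3, h2, x, h4, h5, h7, h6⟩⟩
       loopless := ⟨fun u h => h.1.ne rfl⟩ }, fun u v => Iff.rfl⟩
  have hJfree : CycFreeOn J (2 * t) S := by
    rintro f ⟨hinj, hadj, hlast⟩
    by_contra hcon
    push Not at hcon
    obtain ⟨-, -, -, x, hxS, hxA, hx1, hx2⟩ := (hJ _ _).1 hlast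
    have hfA : ∀ i ≤ 2 * t - 1, f i ∈ A := by
      intro i hi
      by_cases h : i + 1 < 2 * t
      · exact ((hJ _ _).1 (hadj i h)).2.1
      · rw [show i = 2 * t - 1 by omega]
        exact ((hJ _ _).1 hlast).2.1
    have hcyc := isCyc_of_path (G := G) (f := f) (v := x) (n := 2 * t - 1)
      (fun i hi j hj => hinj i (by omega) j (by omega))
      (fun i hi => ((hJ _ _).1 (hadj i (by omega))).1)
      (fun i hi h => hxA (h ▸ hfA i hi)) hx2.symm hx1
    rw [show 2 * t - 1 + 2 = 2 * t + 1 by omega] at hcyc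
    obtain ⟨i, -, hi⟩ := hG _ hcyc
    split_ifs at hi with h
    · exact hi (hcon i (by omega))
    · exact hi hxS
  have hsub : {e ∈ E | e.1 ∈ A ∧ e.2 ∈ A ∧ w e ∉ A} ⊆ {e ∈ S ×ˢ S | J.Adj e.1 e.2} := by
    intro e he
    rw [mem_filter] at he
    have hwe := hw e he.1
    rw [hE, mem_filter] at he
    exact mem_filter.2 ⟨he.1.1, (hJ _ _).2 ⟨he.1.2.1, he.2.1, he.2.2.1, w e, hwe.1, he.2.2.2,
      hwe.2⟩⟩
  have h1 : (#E : ℝ) ≤ 8 * #{e ∈ S ×ˢ S | J.Adj e.1 e.2} := by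
    exact_mod_cast hA.trans (Nat.mul_le_mul_left _ (card_le_card hsub))
  have h2 := card_adj_pairs_le_of_cycFreeOn ht hJfree
  linarith

/-- A graph on `n` vertices without cycles of length `l`, where `l` is `2 * t` or `2 * t + 1`, has
`O(n ^ (1 + 1 / t))` cliques with `j` vertices, provided that `2 ≤ j` or `3 ≤ j` respectively. -/
lemma cliqueCount_le_rpow_of_cycFreeOn {V : Type*} {G : SimpleGraph V} {S : Finset V} {t l j : ℕ}
    (ht : t ≠ 0) (hlj : (l = 2 * t ∧ 2 ≤ j) ∨ (l = 2 * t + 1 ∧ 3 ≤ j)) (hG : CycFreeOn G l S) :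
    (cliqueCount G j S : ℝ) ≤
      192 * (2 * t * t + 1) * (l : ℝ) ^ (j - 2) * (#S : ℝ) ^ (1 + 1 / (t : ℝ)) := by
  classical
  rcases hlj with ⟨rfl, hj⟩ | ⟨rfl, hj⟩
  · obtain ⟨k, rfl⟩ := Nat.exists_eq_add_of_le' hj
    have h1 : (cliqueCount G (k + 2) S : ℝ) ≤
        #{e ∈ S ×ˢ S | G.Adj e.1 e.2} * ((2 * t : ℕ) : ℝ) ^ k := by
      exact_mod_cast cliqueCount_le_of_cycFreeOn (by omega) hG k
    have h2 := card_adj_pairs_le_of_cycFreeOn ht hG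
    have h3 : (0 : ℝ) ≤ (2 * t * t + 1) * (#S : ℝ) ^ (1 + 1 / (t : ℝ)) := by positivity
    calc _ ≤ _ := h1
      _ ≤ (192 * (2 * t * t + 1) * (#S : ℝ) ^ (1 + 1 / (t : ℝ))) * ((2 * t : ℕ) : ℝ) ^ k := by
          gcongr; linarith
      _ = _ := by rw [Nat.add_sub_cancel]; ring
  · obtain ⟨k, rfl⟩ := Nat.exists_eq_add_of_le' hj
    have h1 : (cliqueCount G (k + 3) S : ℝ) ≤
        #{e ∈ S ×ˢ S | G.Adj e.1 e.2 ∧ ∃ w ∈ S, G.Adj e.1 w ∧ G.Adj e.2 w} *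
          ((2 * t + 1 : ℕ) : ℝ) ^ (k + 1) := by
      exact_mod_cast cliqueCount_le_of_cycFreeOn_triangle (by omega) hG k
    have h2 := card_triangle_pairs_le_of_cycFreeOn ht hG
    calc _ ≤ _ := h1
      _ ≤ (192 * (2 * t * t + 1) * (#S : ℝ) ^ (1 + 1 / (t : ℝ))) *
          ((2 * t + 1 : ℕ) : ℝ) ^ (k + 1) := by gcongr
      _ = _ := by rw [show k + 3 - 2 = k + 1 by omega]; ring

/-! ### Cliques in graphs without a join of a clique and a cycle -/

/-- The subgraph of `G` induced by `S` contains no join of a clique on `s` vertices and a cycle of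
length `l`. -/
def JoinFreeOn {V : Type*} (G : SimpleGraph V) (s l : ℕ) (S : Finset V) : Prop :=
  ∀ K ⊆ S, G.IsNClique s K → ∀ f, IsCyc G l f → (∀ i < l, f i ∈ S) →
    ¬ ∀ k ∈ K, ∀ i < l, G.Adj k (f i)

lemma JoinFreeOn.cycFreeOn {V : Type*} {G : SimpleGraph V} {l : ℕ} {S : Finset V}
    (h : JoinFreeOn G 0 l S) : CycFreeOn G l S := by
  intro f hf
  by_contra hcon
  push Not at hcon
  exact h ∅ (empty_subset _) (by simp [isNClique_iff]) f hf hcon (by simp)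

open scoped Classical in
lemma JoinFreeOn.nbr {V : Type*} {G : SimpleGraph V} {s l : ℕ} {S T : Finset V}
    (h : JoinFreeOn G (s + 1) l S) {v : V} (hv : v ∈ S) (hT : T ⊆ {w ∈ S | G.Adj v w}) :
    JoinFreeOn G s l T := by
  intro K hK hKs f hf hfT hadj
  have hT' : ∀ w ∈ T, w ∈ S ∧ G.Adj v w := fun w hw => mem_filter.1 (hT hw)
  refine h (insert v K) (insert_subset hv fun k hk => (hT' k (hK hk)).1)
    (hKs.insert fun k hk => (hT' k (hK hk)).2) f hf (fun i hi => (hT' _ (hfT i hi)).1) ?_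
  intro k hk i hi
  rcases mem_insert.1 hk with rfl | hk
  · exact (hT' _ (hfT i hi)).2
  · exact hadj k hk i hi

lemma IsCyc.adj_of_cycleGraph_adj {V : Type*} {G : SimpleGraph V} {l : ℕ} {f : ℕ → V}
    (hf : IsCyc G l f) {u v : Fin l} (huv : (cycleGraph l).Adj u v) : G.Adj (f u) (f v) := by
  have key : ∀ u v : Fin l, (u - v).val = 1 → G.Adj (f v) (f u) := by
    intro u v h
    rw [Fin.sub_def] at h
    dsimp only at h
    have hu := u.2
    have hv := v.2
    by_cases hlt : l - v + u < l
    · rw [Nat.mod_eq_of_lt hlt] at h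
      have hu0 : (u : ℕ) = 0 := by omega
      have hvl : (v : ℕ) = l - 1 := by omega
      rw [hu0, hvl]
      exact hf.2.2
    · rw [Nat.mod_eq_sub_mod (by omega), Nat.mod_eq_of_lt (by omega)] at h
      have hvu : (u : ℕ) = v + 1 := by omega
      rw [hvu]
      exact hf.2.1 _ (by omega)
  rcases cycleGraph_adj'.1 huv with h | h
  · exact (key u v h).symm
  · exact key v u h

lemma joinFreeOn_of_free {V : Type*} {G : SimpleGraph V} {s l : ℕ}
    (h : (graphJoin (completeGraph (Fin s)) (cycleGraph l)).Free G) (S : Finset V) :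
    JoinFreeOn G s l S := by
  intro K _ hK f hf _ hadj
  let e : Fin s ≃ K := (K.equivFinOfCardEq hK.card_eq).symm
  refine h ⟨⟨⟨Sum.elim (fun i => (e i : V)) (fun i => f i), ?_⟩, ?_⟩⟩
  · rintro (a | a) (b | b) hab
    · simp only [graphJoin, sup_adj, Sum.elim_inl] at hab ⊢
      have hab' : a ≠ b := by
        rintro rfl
        simp [completeBipartiteGraph] at hab
      exact hK.isClique (e a).2 (e b).2 fun h => hab' (e.injective (Subtype.ext h))
    · exact hadj _ (e a).2 _ b.2
    · exact (hadj _ (e b).2 _ a.2).symm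
    · refine hf.adj_of_cycleGraph_adj ?_
      simpa [graphJoin, completeBipartiteGraph] using hab
  · rintro (a | a) (b | b) hab
    · exact congrArg Sum.inl (e.injective (Subtype.ext hab))
    · exact absurd hab (hadj _ (e a).2 _ b.2).ne
    · exact absurd hab.symm (hadj _ (e b).2 _ a.2).ne
    · exact congrArg Sum.inr (Fin.ext (hf.1 _ a.2 _ b.2 hab))

/-- A bound for cliques in sets without an `l`-cycle yields one for sets of at most `D` vertices
without a join of an `s`-clique and an `l`-cycle: each vertex of the `s`-clique costs a factor
`D`. -/
lemma JoinFreeOn.cliqueCount_le {V : Type*} {G : SimpleGraph V} {l j : ℕ} {c a D : ℝ}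
    (hc : 0 ≤ c) (ha : 0 ≤ a)
    (hbase : ∀ S : Finset V, CycFreeOn G l S → (cliqueCount G j S : ℝ) ≤ c * (#S : ℝ) ^ (1 + a))
    (s : ℕ) (S : Finset V) (hS : JoinFreeOn G s l S) (hD : (#S : ℝ) ≤ D) :
    (cliqueCount G (s + j) S : ℝ) ≤ c * D ^ s * D ^ a * #S := by
  classical
  have hD0 : 0 ≤ D := (Nat.cast_nonneg _).trans hD
  have hDa : 0 ≤ D ^ a := Real.rpow_nonneg hD0 a
  induction s generalizing S with
  | zero =>
    rw [zero_add, pow_zero, mul_one]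
    refine (hbase S hS.cycFreeOn).trans ?_
    rw [Real.rpow_add_of_nonneg (by positivity) zero_le_one ha, Real.rpow_one,
      mul_comm (#S : ℝ), ← mul_assoc]
    gcongr
  | succ s ih =>
    have h1 : (cliqueCount G (s + 1 + j) S : ℝ) ≤
        ∑ v ∈ S, (cliqueCount G (s + j) {w ∈ S | G.Adj v w} : ℝ) := by
      rw [add_right_comm]
      exact_mod_cast cliqueCount_succ_le_sum_nbr G (s + j) S
    refine h1.trans ?_
    calc _ ≤ ∑ v ∈ S, c * D ^ s * D ^ a * D := by
          refine sum_le_sum fun v hv => ?_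
          have hle : (#{w ∈ S | G.Adj v w} : ℝ) ≤ D :=
            le_trans (by exact_mod_cast card_filter_le _ _) hD
          refine (ih _ (hS.nbr hv subset_rfl) hle).trans ?_
          gcongr
      _ = _ := by rw [sum_const, nsmul_eq_mul]; ring

/-! ### Counting cliques by a vertex of least degree -/

open scoped Classical in
/-- The neighbours of `v` whose degree is at least that of `v`. -/
noncomputable def upNbr {V : Type*} [Fintype V] (G : SimpleGraph V) (v : V) : Finset V :=
  {w | G.Adj v w ∧ G.degree v ≤ G.degree w}

open scoped Classical in
lemma card_upNbr_le {V : Type*} [Fintype V] (G : SimpleGraph V) (v : V) :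
    #(upNbr G v) ≤ G.degree v := by
  rw [← card_neighborFinset_eq_degree]
  refine card_le_card fun w hw => ?_
  simp only [upNbr, mem_filter] at hw
  simpa using hw.2.1

lemma sum_degree_eq_of_ncard {V : Type*} [Fintype V] {G : SimpleGraph V} [DecidableRel G.Adj]
    {m : ℕ} (hm : G.edgeSet.ncard = m) : ∑ v, G.degree v = 2 * m := by
  classical
  rw [G.sum_degrees_eq_twice_card_edges, ← hm, ← coe_edgeFinset, Set.ncard_coe_finset]

lemma card_upNbr_le_sqrt {V : Type*} [Fintype V] {G : SimpleGraph V} {m : ℕ}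
    (hm : G.edgeSet.ncard = m) (v : V) : (#(upNbr G v) : ℝ) ≤ √(2 * m) := by
  classical
  refine Real.le_sqrt_of_sq_le ?_
  have h : #(upNbr G v) * #(upNbr G v) ≤ 2 * m := by
    rw [← sum_degree_eq_of_ncard hm, ← smul_eq_mul]
    refine (card_nsmul_le_sum (upNbr G v) (fun w => G.degree w) _ fun w hw => ?_).trans
      (sum_le_sum_of_subset (subset_univ _))
    simp only [upNbr, mem_filter] at hw
    exact (card_upNbr_le G v).trans (by convert hw.2.2)
  rw [sq]
  exact_mod_cast h

/-- Every clique is counted at one of its vertices of least degree, where the rest of it is among at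
most `√(2 * m)` neighbours. -/
lemma cliqueCount_univ_le {V : Type*} [Fintype V] {G : SimpleGraph V} {m : ℕ}
    (hm : G.edgeSet.ncard = m) {k : ℕ} {B : ℝ} (hB : 0 ≤ B)
    (h : ∀ v, (cliqueCount G k (upNbr G v) : ℝ) ≤ B * #(upNbr G v)) :
    (cliqueCount G (k + 1) univ : ℝ) ≤ B * (2 * m) := by
  classical
  have h1 : cliqueCount G (k + 1) univ ≤ ∑ v, cliqueCount G k (upNbr G v) := by
    refine cliqueCount_succ_le_sum G k univ (upNbr G) fun K _ hK => ?_
    obtain ⟨v, hv, hmin⟩ := exists_min_image K (fun v => G.degree v)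
      (card_pos.1 (by rw [hK.card_eq]; omega))
    refine ⟨v, hv, fun w hw => ?_⟩
    rw [mem_erase] at hw
    simp only [upNbr, mem_filter, mem_univ, true_and]
    exact ⟨hK.isClique hv hw.2 hw.1.symm, by convert hmin w hw.2⟩
  calc (cliqueCount G (k + 1) univ : ℝ) ≤ ∑ v, (cliqueCount G k (upNbr G v) : ℝ) := by
        exact_mod_cast h1
    _ ≤ ∑ v, B * (G.degree v : ℝ) := by
        refine sum_le_sum fun v _ => (h v).trans ?_
        have := card_upNbr_le G v
        gcongr
    _ = _ := by
        rw [← mul_sum]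
        exact_mod_cast congrArg (fun n : ℕ => B * (n : ℝ)) (sum_degree_eq_of_ncard hm)

lemma cliqueCount_univ_le_rpow {V : Type*} [Fintype V] {G : SimpleGraph V} {m r : ℕ}
    (hr : 2 ≤ r) (hm : G.edgeSet.ncard = m) :
    (cliqueCount G r univ : ℝ) ≤ 2 ^ ((r : ℝ) / 2) * (m : ℝ) ^ ((r : ℝ) / 2) := by
  obtain ⟨k, rfl⟩ := Nat.exists_eq_add_of_le' hr
  have h := cliqueCount_univ_le hm (k := k + 1) (B := √(2 * m) ^ k) (by positivity) (by
    intro v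
    calc (cliqueCount G (k + 1) (upNbr G v) : ℝ) ≤ (#(upNbr G v) : ℝ) ^ (k + 1) := by
          exact_mod_cast cliqueCount_le_pow G (k + 1) (upNbr G v)
      _ = (#(upNbr G v) : ℝ) ^ k * #(upNbr G v) := pow_succ _ _
      _ ≤ _ := by
          have := card_upNbr_le_sqrt hm v
          gcongr)
  refine h.trans_eq ?_
  have hsq : (2 * m : ℝ) = √(2 * m) ^ 2 := (Real.sq_sqrt (by positivity)).symm
  nth_rewrite 2 [hsq]
  rw [← pow_add, ← Real.mul_rpow (by positivity) (by positivity), Real.sqrt_eq_rpow,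
    ← Real.rpow_mul_natCast (by positivity)]
  congr 1
  push_cast
  ring

lemma cliqueCount_univ_le_rpow_of_joinFreeOn {V : Type*} [Fintype V] {G : SimpleGraph V}
    {m s j t l : ℕ} (ht : t ≠ 0) (hs : 1 ≤ s)
    (hlj : (l = 2 * t ∧ 2 ≤ j) ∨ (l = 2 * t + 1 ∧ 3 ≤ j)) (hm : G.edgeSet.ncard = m)
    (hG : JoinFreeOn G s l univ) :
    (cliqueCount G (s + j) univ : ℝ) ≤
      192 * (2 * t * t + 1) * (l : ℝ) ^ (j - 2) * 2 ^ (((s : ℝ) + 1) / 2 + 1 / (2 * (t : ℝ))) *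
        (m : ℝ) ^ (((s : ℝ) + 1) / 2 + 1 / (2 * (t : ℝ))) := by
  classical
  obtain ⟨s, rfl⟩ := Nat.exists_eq_add_of_le' hs
  set c : ℝ := 192 * (2 * t * t + 1) * (l : ℝ) ^ (j - 2) with hc
  have hc0 : 0 ≤ c := by positivity
  have h := cliqueCount_univ_le hm (k := s + j) (B := c * √(2 * m) ^ s * √(2 * m) ^ (1 / (t : ℝ)))
    (by positivity) (fun v => JoinFreeOn.cliqueCount_le (l := l) hc0 (by positivity)
      (fun S hS => cliqueCount_le_rpow_of_cycFreeOn ht hlj hS) s (upNbr G v)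
      (hG.nbr (mem_univ v) fun w hw => by
        simp only [upNbr, mem_filter] at hw
        exact mem_filter.2 ⟨mem_univ _, hw.2.1⟩) (card_upNbr_le_sqrt hm v))
  rw [add_right_comm]
  refine h.trans_eq ?_
  rw [mul_assoc c (2 ^ _), ← Real.mul_rpow (by positivity) (by positivity)]
  have hx : (0 : ℝ) ≤ 2 * m := by positivity
  have hsq : (2 * m : ℝ) = (2 * m : ℝ) ^ (1 : ℝ) := (Real.rpow_one _).symm
  rw [Real.sqrt_eq_rpow, ← Real.rpow_mul_natCast hx, ← Real.rpow_mul hx, mul_assoc, mul_assoc]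
  nth_rewrite 3 [hsq]
  rw [← Real.rpow_add_of_nonneg hx (by positivity) (by positivity),
    ← Real.rpow_add_of_nonneg hx (by positivity) (by positivity)]
  congr 2
  push_cast
  field_simp
  ring

/-! ### Copies of complete graphs are cliques -/

lemma copyCount_completeGraph_eq_cliqueCount {V : Type*} [Fintype V] (G : SimpleGraph V) (r : ℕ) :
    G.copyCount (completeGraph (Fin r)) = cliqueCount G r univ := by
  classical
  have key : ∀ G' : G.Subgraph, Nonempty (completeGraph (Fin r) ≃g G'.coe) →
      ∀ a b, G'.Adj a b ↔ a ∈ G'.verts ∧ b ∈ G'.verts ∧ a ≠ b := by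
    rintro G' ⟨e⟩ a b
    refine ⟨fun h => ⟨G'.edge_vert h, G'.edge_vert h.symm, h.ne⟩, fun ⟨ha, hb, hab⟩ => ?_⟩
    have hne : e.symm ⟨a, ha⟩ ≠ e.symm ⟨b, hb⟩ := by simpa using hab
    have := e.map_adj_iff.2 (show (completeGraph (Fin r)).Adj _ _ from hne)
    simpa using this
  unfold SimpleGraph.copyCount cliqueCount
  refine le_antisymm (card_le_card_of_injOn (fun G' => G'.verts.toFinset) ?_ ?_)
    (card_le_card_of_injOn (fun K => (⊤ : G.Subgraph).induce (K : Set V)) ?_ ?_)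
  · intro G' hG'
    simp only [coe_filter, mem_univ, true_and, Set.mem_ofPred_eq] at hG'
    simp only [coe_filter, mem_powerset, subset_univ, true_and, Set.mem_ofPred_eq]
    refine ⟨fun a ha b hb hab => ?_, ?_⟩
    · exact G'.adj_sub ((key G' hG' a b).2 ⟨by simpa using ha, by simpa using hb, hab⟩)
    · obtain ⟨e⟩ := hG'
      rw [Set.toFinset_card, ← Fintype.card_congr e.toEquiv, Fintype.card_fin]
  · intro A hA B hB hAB
    simp only [coe_filter, mem_univ, true_and, Set.mem_ofPred_eq] at hA hB
    have hv : A.verts = B.verts := by simpa using hAB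
    refine Subgraph.ext hv ?_
    ext a b
    rw [key A hA, key B hB, hv]
  · intro K hK
    simp only [coe_filter, mem_powerset, subset_univ, true_and, Set.mem_ofPred_eq] at hK ⊢
    simp only [mem_univ, true_and]
    let e : Fin r ≃ K := (K.equivFinOfCardEq hK.card_eq).symm
    refine ⟨⟨e, ?_⟩⟩
    intro a b
    simp only [Subgraph.coe_adj, Subgraph.induce_adj, Subgraph.top_adj]
    constructor
    · rintro ⟨-, -, h⟩ rfl
      exact h.ne rfl
    · intro h
      exact ⟨(e a).2, (e b).2, hK.isClique (e a).2 (e b).2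
        fun h' => h (e.injective (Subtype.ext h'))⟩
  · intro A _ B _ hAB
    have := congrArg Subgraph.verts hAB
    simpa using this

/-! ### Graphs of small chromatic number with many cliques -/

lemma not_colorable_graphJoin {W : Type*} {H : SimpleGraph W} {s c : ℕ} (hH : ¬ H.Colorable c) :
    ¬ (graphJoin (completeGraph (Fin s)) H).Colorable (s + c) := by
  classical
  rintro ⟨C⟩
  have hinj : Function.Injective fun i : Fin s => C (Sum.inl i) := by
    intro i j hij
    by_contra hne
    exact C.valid (show (graphJoin (completeGraph (Fin s)) H).Adj (Sum.inl i) (Sum.inl j) by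
      simpa [graphJoin] using hne) hij
  -- the colours that the clique leaves for `H`
  let κ := {x : Fin (s + c) // x ∉ Set.range fun i : Fin s => C (Sum.inl i)}
  have hκ : Fintype.card κ = c := by
    rw [Fintype.card_subtype_compl, Fintype.card_fin]
    exact (congrArg (s + c - ·) ((Fintype.card_congr (Equiv.ofInjective _ hinj)).symm.trans
      (Fintype.card_fin s))).trans (Nat.add_sub_cancel_left s c)
  let D : H.Coloring κ := Coloring.mk
    (fun w => ⟨C (Sum.inr w), fun ⟨i, hi⟩ => C.valid
      (show (graphJoin (completeGraph (Fin s)) H).Adj (Sum.inl i) (Sum.inr w) by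
        simp [graphJoin, completeBipartiteGraph]) hi⟩)
    (fun {v w} hvw h => C.valid
      (show (graphJoin (completeGraph (Fin s)) H).Adj (Sum.inr v) (Sum.inr w) by
        simpa [graphJoin, completeBipartiteGraph] using hvw) (congrArg Subtype.val h))
  exact hH (hκ ▸ D.colorable)

/-- For `(r * N) ^ 2 ≤ m` there is an `r`-colourable graph with exactly `m` edges that contains the
complete `r`-partite graph with parts of size `N`: add edges to the latter inside the complete
`r`-partite graph with parts of size `m`. -/
lemma exists_colorable_pow_le_cliqueCount {r N m : ℕ} (hr : 2 ≤ r) (hm : 1 ≤ m)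
    (hN : (r * N) ^ 2 ≤ m) : ∃ G : SimpleGraph (Fin (r * m)),
      G.Colorable r ∧ G.edgeSet.ncard = m ∧ N ^ r ≤ cliqueCount G r univ := by
  classical
  have hNm : N ≤ m := by
    calc N ≤ r * N := Nat.le_mul_of_pos_left _ (by omega)
      _ ≤ (r * N) ^ 2 := Nat.le_self_pow (by omega) _
      _ ≤ m := hN
  let e : Fin r × Fin m ≃ Fin (r * m) := finProdFinEquiv
  let K : SimpleGraph (Fin (r * m)) := (⊤ : SimpleGraph (Fin r)).comap fun u => (e.symm u).1
  have hK : ∀ a b, K.Adj (e a) (e b) ↔ a.1 ≠ b.1 := by simp [K]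
  let T := {x ∈ K.edgeFinset | ∀ u ∈ x, ((e.symm u).2 : ℕ) < N}
  have hT : #T ≤ m := by
    let W : Finset (Fin (r * m)) := {u | ((e.symm u).2 : ℕ) < N}
    have hW : #W ≤ r * N := by
      have : #W ≤ #((univ : Finset (Fin r)) ×ˢ range N) := by
        refine card_le_card_of_injOn (fun u => ((e.symm u).1, ((e.symm u).2 : ℕ))) ?_ ?_
        · intro u hu
          simpa [W] using hu
        · intro u _ v _ huv
          simp only [Prod.mk.injEq] at huv
          exact e.symm.injective (Prod.ext huv.1 (Fin.ext huv.2))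
      simpa using this
    have hTW : T ⊆ (W ×ˢ W).image fun x => s(x.1, x.2) := by
      intro x hx
      induction x with
      | _ u v =>
        have h := (mem_filter.1 hx).2
        refine mem_image.2 ⟨(u, v), mem_product.2 ⟨?_, ?_⟩, rfl⟩
        · exact mem_filter.2 ⟨mem_univ _, h u (Sym2.mem_mk_left u v)⟩
        · exact mem_filter.2 ⟨mem_univ _, h v (Sym2.mem_mk_right u v)⟩
    calc #T ≤ #W * #W := (card_le_card hTW).trans (card_image_le.trans (card_product _ _).le)
      _ ≤ (r * N) * (r * N) := Nat.mul_le_mul hW hW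
      _ ≤ m := by rwa [← sq]
  have hKm : m ≤ #K.edgeFinset := by
    have : #(univ : Finset (Fin m)) ≤ #K.edgeFinset := by
      refine card_le_card_of_injOn
        (fun i => s(e (⟨0, by omega⟩, i), e (⟨1, by omega⟩, ⟨0, by omega⟩))) ?_ ?_
      · intro i _
        rw [coe_edgeFinset, mem_edgeSet, hK]
        simp
      · intro i _ j _ hij
        simpa using hij
    simpa using this
  obtain ⟨U, hTU, hUK, hU⟩ := exists_subsuperset_card_eq (filter_subset _ _) hT hKm
  have hdiag : ∀ x ∈ U, ¬ x.IsDiag := fun x hx =>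
    K.not_isDiag_of_mem_edgeSet (mem_edgeFinset.1 (hUK hx))
  refine ⟨fromEdgeSet U, ?_, ?_, ?_⟩
  · refine Colorable.mono_left (G' := K) (fun a b hab => ?_)
      ⟨Coloring.mk (fun u => (e.symm u).1) fun {u v} huv => huv⟩
    rw [fromEdgeSet_adj] at hab
    exact mem_edgeFinset.1 (hUK hab.1)
  · rw [edgeSet_fromEdgeSet]
    refine Eq.trans ?_ ((Set.ncard_coe_finset U).trans hU)
    congr 1
    exact sdiff_eq_left.2 (Set.disjoint_left.2 fun x hx hd => hdiag x hx hd)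
  · have : #(univ : Finset (Fin r → Fin N)) ≤
        cliqueCount (fromEdgeSet (U : Set (Sym2 (Fin (r * m))))) r univ := by
      refine card_le_card_of_injOn
        (fun f => univ.image fun i => e (i, Fin.castLE hNm (f i))) ?_ ?_
      · intro f _
        simp only [coe_filter, mem_powerset, subset_univ, true_and, Set.mem_ofPred_eq]
        refine ⟨?_, ?_⟩
        · intro a ha b hb hab
          simp only [coe_image, coe_univ, Set.image_univ, Set.mem_range] at ha hb
          obtain ⟨i, rfl⟩ := ha
          obtain ⟨j, rfl⟩ := hb
          rw [fromEdgeSet_adj]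
          refine ⟨hTU (mem_filter.2 ⟨mem_edgeFinset.2 ?_, ?_⟩), hab⟩
          · rw [mem_edgeSet, hK]
            rintro (rfl : i = j)
            exact hab rfl
          · intro u hu
            rcases Sym2.mem_iff.1 hu with rfl | rfl <;> simp
        · rw [card_image_of_injective, card_univ, Fintype.card_fin]
          intro i j hij
          exact (Prod.mk.inj (e.injective hij)).1
      · intro f _ g _ hfg
        dsimp only at hfg
        ext i
        have : e (i, Fin.castLE hNm (f i)) ∈
            univ.image fun i => e (i, Fin.castLE hNm (g i)) := by
          rw [← hfg]
          exact mem_image_of_mem _ (mem_univ i)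
        obtain ⟨j, -, hj⟩ := mem_image.1 this
        have h := Prod.mk.inj (e.injective hj)
        obtain rfl : j = i := h.1
        simpa using congrArg Fin.val h.2.symm
    simpa using this

/-- An `r`-colourable graph contains no copy of a graph that is not `r`-colourable, so the number of
`K_r`-copies is as large as in a balanced complete `r`-partite graph. -/
lemma rpow_le_mex {W : Type*} {F : SimpleGraph W} {r m : ℕ} (hr : 2 ≤ r) (hF : ¬ F.Colorable r)
    (hm : 4 * r ^ 2 ≤ m) :
    (1 / (2 * r) : ℝ) ^ r * (m : ℝ) ^ ((r : ℝ) / 2) ≤ mex m (completeGraph (Fin r)) F := by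
  have hr0 : (0 : ℝ) < r := by exact_mod_cast (by omega : 0 < r)
  have hm1 : 1 ≤ m := le_trans (by nlinarith) hm
  set N := ⌊√(m : ℝ) / r⌋₊ with hN
  have hsq : 2 * (r : ℝ) ≤ √m := by
    refine Real.le_sqrt_of_sq_le ?_
    have : (4 * r ^ 2 : ℝ) ≤ m := by exact_mod_cast hm
    linarith
  have hNle : (r : ℝ) * N ≤ √m := by
    have := Nat.floor_le (show 0 ≤ √(m : ℝ) / r by positivity)
    rw [le_div_iff₀ hr0] at this
    rw [mul_comm]
    exact this
  have hNge : 1 / (2 * r) * √(m : ℝ) ≤ N := by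
    have h1 := Nat.lt_floor_add_one (√(m : ℝ) / r)
    have h2 : 1 ≤ 1 / (2 * r) * √(m : ℝ) := by
      rw [one_div, ← div_eq_inv_mul, le_div_iff₀ (by positivity)]
      linarith
    have h3 : √(m : ℝ) / r = 2 * (1 / (2 * r) * √(m : ℝ)) := by field_simp
    rw [← hN, h3] at h1
    linarith
  have hNm : (r * N) ^ 2 ≤ m := by
    have : ((r : ℝ) * N) ^ 2 ≤ m := by
      rw [← Real.sq_sqrt (Nat.cast_nonneg m)]
      gcongr
    exact_mod_cast this
  obtain ⟨G, hcol, hedge, hcl⟩ := exists_colorable_pow_le_cliqueCount hr hm1 hNm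
  have hmem : G.copyCount (completeGraph (Fin r)) ∈ mexValues m (completeGraph (Fin r)) F :=
    ⟨_, G, free_of_colorable hF hcol, hedge, rfl⟩
  have hbdd := mexValues_bddAbove m (completeGraph (Fin r)) F (by
    intro v
    have : Nontrivial (Fin r) := Fin.nontrivial_iff_two_le.2 hr
    obtain ⟨w, hw⟩ := exists_ne v
    exact ⟨w, hw.symm⟩)
  have hle : N ^ r ≤ mex m (completeGraph (Fin r)) F := by
    refine hcl.trans ?_
    rw [← copyCount_completeGraph_eq_cliqueCount]
    exact le_csSup hbdd hmem
  have hrpow : (m : ℝ) ^ ((r : ℝ) / 2) = √m ^ r := by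
    rw [Real.sqrt_eq_rpow, ← Real.rpow_mul_natCast (by positivity)]
    congr 1
    ring
  rw [hrpow, ← mul_pow]
  calc _ ≤ (N : ℝ) ^ r := by gcongr
    _ ≤ _ := by exact_mod_cast hle

lemma not_colorable_cycleGraph {l c : ℕ} (hl : 2 ≤ l)
    (h : (Even l ∧ c = 1) ∨ (Odd l ∧ c = 2)) : ¬ (cycleGraph l).Colorable c := by
  intro hc
  have h1 := hc.chromaticNumber_le
  rcases h with ⟨hl', rfl⟩ | ⟨hl', rfl⟩
  · rw [chromaticNumber_cycleGraph_of_even l hl hl'] at h1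
    norm_num at h1
  · rw [chromaticNumber_cycleGraph_of_odd l hl hl'] at h1
    norm_num at h1

/-! ### The order of magnitude of `mex` -/

/-- An extremal graph: one whose number of `r`-cliques is the value of `mex`. -/
lemma exists_cliqueCount_eq_mex (m : ℕ) {r s l : ℕ} (hr : 2 ≤ r) (hs : 1 ≤ s) (hl : 2 ≤ l) :
    ∃ (n : ℕ) (G : SimpleGraph (Fin n)), G.edgeSet.ncard = m ∧ JoinFreeOn G s l univ ∧
      mex m (completeGraph (Fin r)) (graphJoin (completeGraph (Fin s)) (cycleGraph l)) =
        cliqueCount G r univ := by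
  obtain ⟨n, G, hfree, hm, hG⟩ := (mex_isGreatest m r s l hr hs hl).1
  exact ⟨n, G, hm, joinFreeOn_of_free hfree univ,
    by rw [← hG, copyCount_completeGraph_eq_cliqueCount]⟩

theorem mainTheorem7 (r l s : ℕ) (hr : 3 ≤ r) (hl : 4 ≤ l) (hs : 1 ≤ s) :
    (∀ t : ℕ, 2 ≤ t → ((l = 2 * t ∧ s + 2 ≤ r) ∨ (l = 2 * t + 1 ∧ s + 3 ≤ r)) →
      Asymptotics.IsBigO Filter.atTop
        (fun m : ℕ => (mex m (SimpleGraph.completeGraph (Fin r))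
          (graphJoin (SimpleGraph.completeGraph (Fin s)) (SimpleGraph.cycleGraph l)) : ℝ))
        (fun m : ℕ => (m : ℝ) ^ (((s : ℝ) + 1) / 2 + 1 / (2 * (t : ℝ))))) ∧
    ((¬ ∃ t : ℕ, 2 ≤ t ∧ ((l = 2 * t ∧ s + 2 ≤ r) ∨ (l = 2 * t + 1 ∧ s + 3 ≤ r))) →
      Asymptotics.IsTheta Filter.atTop
        (fun m : ℕ => (mex m (SimpleGraph.completeGraph (Fin r))
          (graphJoin (SimpleGraph.completeGraph (Fin s)) (SimpleGraph.cycleGraph l)) : ℝ))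
        (fun m : ℕ => (m : ℝ) ^ ((r : ℝ) / 2))) := by

  refine ⟨fun t ht hlt => ?_, fun hnot => ⟨?_, ?_⟩⟩
  · obtain ⟨j, rfl⟩ : ∃ j, r = s + j := ⟨r - s, by omega⟩
    refine Asymptotics.IsBigO.of_bound (192 * (2 * t * t + 1) * (l : ℝ) ^ (j - 2) *
      2 ^ (((s : ℝ) + 1) / 2 + 1 / (2 * (t : ℝ)))) (Filter.Eventually.of_forall fun m => ?_)
    obtain ⟨n, G, hm, hG, hmex⟩ := exists_cliqueCount_eq_mex m (r := s + j) (by omega) hs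
      (by omega : 2 ≤ l)
    rw [hmex, Real.norm_of_nonneg (by positivity), Real.norm_of_nonneg (by positivity)]
    exact cliqueCount_univ_le_rpow_of_joinFreeOn (by omega) hs (by omega) hm hG
  · refine Asymptotics.IsBigO.of_bound (2 ^ ((r : ℝ) / 2)) (Filter.Eventually.of_forall fun m => ?_)
    obtain ⟨n, G, hm, -, hmex⟩ := exists_cliqueCount_eq_mex m (r := r) (by omega) hs
      (by omega : 2 ≤ l)
    rw [hmex, Real.norm_of_nonneg (by positivity), Real.norm_of_nonneg (by positivity)]
    exact cliqueCount_univ_le_rpow (by omega) hm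
  · have hF : ¬ (graphJoin (completeGraph (Fin s)) (cycleGraph l)).Colorable r := by
      obtain ⟨c, hc, hrc⟩ : ∃ c, ((Even l ∧ c = 1) ∨ (Odd l ∧ c = 2)) ∧ r ≤ s + c := by
        obtain ⟨t, rfl | rfl⟩ := Nat.even_or_odd' l
        · refine ⟨1, Or.inl ⟨even_two_mul t, rfl⟩, ?_⟩
          by_contra hcon
          exact hnot ⟨t, by omega, Or.inl ⟨rfl, by omega⟩⟩
        · refine ⟨2, Or.inr ⟨odd_two_mul_add_one t, rfl⟩, ?_⟩
          by_contra hcon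
          exact hnot ⟨t, by omega, Or.inr ⟨rfl, by omega⟩⟩
      exact fun h => not_colorable_graphJoin (not_colorable_cycleGraph (by omega) hc) (h.mono hrc)
    have hr0 : (0 : ℝ) < r := by exact_mod_cast (by omega : 0 < r)
    refine Asymptotics.IsBigO.of_bound ((1 / (2 * r) : ℝ) ^ r)⁻¹
      (Filter.eventually_atTop.2 ⟨4 * r ^ 2, fun m hm => ?_⟩)
    rw [Real.norm_of_nonneg (by positivity), Real.norm_of_nonneg (by positivity),
      le_inv_mul_iff₀ (by positivity)]
    exact rpow_le_mex (by omega) hF hm
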